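/- **Setting (one-shot generalized information hiding).** Let $\mathcal{U},\mathcal{X}$ be standard Borel spaces, $\mathcal{S}^e,\mathcal{S}^d,\mathcal{Y}$ measurable spaces, $\mathsf{L}\ge 1$ an integer, $P_{S^e,S^d}$ a probability distribution on $\mathcal{S}^e\times\mathcal{S}^d$, and $\mathcal{A}$ an arbitrary set of channels (Markov kernels) $A_{Y|X}$ from $\mathcal{X}$ to $\mathcal{Y}$. Let $d_1:\mathcal{S}^e\times\mathcal{X}\to[0,\infty)$ and $d_2:\mathcal{X}\times\mathcal{X}\to[0,\infty)$ be measurable distortion measures and $\mathsf{D}_1,\mathsf{D}_2\in\mathbb{R}$. A *scheme* consists of a measurable encoder $f:\mathcal{S}^e\times[1:\mathsf{L}]\to\mathcal{X}$ and a measurable decoder $\phi:\mathcal{S}^d\times\mathcal{Y}\to[1:\mathsf{L}]\times\mathcal{X}$ (both not depending on which $A\in\mathcal{A}$ is used). Its worst-case failure probability is $$P_e:=\sup_{A\in\mathcal{A}}\mathbf{P}\big(d_1(S^e,X)>\mathsf{D}_1\ \text{ or }\ d_2(X,\hat X)>\mathsf{D}_2\ \text{ or }\ M\ne\hat M\big),$$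 where $(S^e,S^d,M)\sim P_{S^e,S^d}\times\mathrm{Unif}[1:\mathsf{L}]$, $X=f(S^e,M)$, $Y|X\sim A_{Y|X}$ (with $S^e,S^d,M\to X\to Y$ Markov) and $(\hat M,\hat X)=\phi(S^d,Y)$. For $\epsilon\ge 0$ the $\epsilon$-covering number $N_\epsilon(\mathcal{A})\in\{0,1,2,\dots\}\cup\{\infty\}$ is the least cardinality of a subset $\tilde{\mathcal{A}}\subseteq\mathcal{A}$ such that every $A\in\mathcal{A}$ has some $\tilde A\in\tilde{\mathcal{A}}$ with $\sup_{x\in\mathcal{X}}\|A(\cdot|x)-\tilde A(\cdot|x)\|_{\mathrm{TV}}\le\epsilon$, where $\|P-Q\|_{\mathrm{TV}}=\sup_{B}|P(B)-Q(B)|$ over measurable $B$. For a pair $(U,V)$, $\iota(u;v)=\log_2\frac{\mathrm{d}P_{U|V}(\cdot|v)}{\mathrm{d}P_U}(u)\in[-\infty,\infty]$ denotes the information density, for any choice of a regular conditional distribution $P_{U|V}$ (a Markov kernel) and any version, jointly measurable in $(u,v)$, of the densities, the density being $\infty$ on the $P_U$-null set that carries the part of $P_{U|V}(\cdot|v)$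 singular to $P_U$. **Theorem.** Fix any $P_{U,X|S^e}$ (a Markov kernel from $\mathcal{S}^e$ to $\mathcal{U}\times\mathcal{X}$), any channel $\hat A_{Y|X}$ (a Markov kernel, not necessarily in $\mathcal{A}$) and any measurable reconstruction function $\hat{\mathbf{x}}:\mathcal{U}\times[1:\mathsf{L}]\times\mathcal{S}^d\times\mathcal{Y}\to\mathcal{X}$. Let $\iota(U;S^e)$ and $\hat\iota(U;Y,S^d)$ be the information densities computed from the joint distribution $P_{S^e,S^d}P_{U,X|S^e}\hat A_{Y|X}$, and assume that for every $A\in\mathcal{A}$ both are almost surely finite when $(S^e,S^d,U,X,Y)\sim P_{S^e,S^d}P_{U,X|S^e}A_{Y|X}$. Then for every $\epsilon\ge 0$ there is a scheme with $$P_e\le N_\epsilon(\mathcal{A})\,\sup_{A\in\mathcal{A}}\mathbf{E}_{Y|X\sim A}\bigg[1-\mathbf{1}\{d_1(S^e,X)\le\mathsf{D}_1\}\,\mathbf{1}\{d_2(X,\hat X)\le\mathsf{D}_2\}\Big(1+\mathsf{L}\cdot 2^{-\hat\iota(U;Y,S^d)+\iota(U;S^e)}\Big)^{-1}\bigg]+\epsilon,$$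 where in the expectation $(S^e,S^d,U,X,Y)\sim P_{S^e,S^d}P_{U,X|S^e}A_{Y|X}$, $M\sim\mathrm{Unif}[1:\mathsf{L}]$ is independent of these, and $\hat X=\hat{\mathbf{x}}(U,M,S^d,Y)$. -/

import Mathlib

open MeasureTheory ProbabilityTheory
open scoped ENNReal NNReal

noncomputable section

/-- Total variation distance `sup_B |P(B) - Q(B)|`, the supremum being over measurable sets. -/
def tvDist {α : Type*} [MeasurableSpace α] (P Q : Measure α) : ℝ≥0∞ :=
  ⨆ (B : Set α) (_ : MeasurableSet B), ENNReal.ofReal |P.real B - Q.real B|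

/-- `sup_x ‖A(·|x) - B(·|x)‖_TV` for two channels `A`, `B`. -/
def channelDist {𝒳 𝒴 : Type*} [MeasurableSpace 𝒳] [MeasurableSpace 𝒴] (A B : Kernel 𝒳 𝒴) : ℝ≥0∞ :=
  ⨆ x : 𝒳, tvDist (A x) (B x)

/-- The `ε`-covering number of a set of channels: the least cardinality of a subset `T ⊆ 𝒜` such
that every channel of `𝒜` is within `ε` of a channel of `T` (it is `⊤` if no finite `T` works). -/
def coveringNumber {𝒳 𝒴 : Type*} [MeasurableSpace 𝒳] [MeasurableSpace 𝒴]
    (ε : ℝ≥0) (𝒜 : Set (Kernel 𝒳 𝒴)) : ℕ∞ :=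
  ⨅ (T : Set (Kernel 𝒳 𝒴)) (_ : T ⊆ 𝒜 ∧ ∀ A ∈ 𝒜, ∃ B ∈ T, channelDist A B ≤ (ε : ℝ≥0∞)), T.encard

/-- Logarithm to the base 2 on `[0, ∞]`, with `log₂ 0 = -∞` and `log₂ ∞ = ∞`. -/
def log2E (r : ℝ≥0∞) : EReal :=
  ENNReal.log r / (Real.log 2 : EReal)

/-- `r : α → [0, ∞]` is a version of the Radon-Nikodym derivative `dμ/dν`: the measure `μ` is
`r dν` off `{r = ∞}`, and the part of `μ` singular to `ν` sits on the (`ν`-null) set `{r = ∞}`. -/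
def IsRNDerivVersion {α : Type*} [MeasurableSpace α] (μ ν : Measure α) (r : α → ℝ≥0∞) : Prop :=
  ∀ B : Set α, MeasurableSet B → μ B = (∫⁻ a in B, r a ∂ν) + μ (B ∩ {a | r a = ∞})

/-- `ι` is (a version of) the information density
`ι_{U;V}(u; v) = log₂ (dP_{U|V}(· | v) / dP_U)(u)` of a pair `(U, V)` with joint law `P`.
Here `κ = P_{U|V}` is a regular conditional distribution of `U` given `V`, and the densities
`r(·, v)` of `κ v` with respect to `P_U` are chosen jointly measurable in `(u, v)`. -/
def IsInfoDensity {𝒰 𝒱 : Type*} [MeasurableSpace 𝒰] [MeasurableSpace 𝒱]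
    (P : Measure (𝒰 × 𝒱)) (ι : 𝒰 → 𝒱 → EReal) : Prop :=
  ∃ (κ : Kernel 𝒱 𝒰) (r : 𝒰 → 𝒱 → ℝ≥0∞),
    IsMarkovKernel κ ∧ P.snd ⊗ₘ κ = P.map Prod.swap ∧
    Measurable (Function.uncurry r) ∧
    (∀ v, IsRNDerivVersion (κ v) P.fst (fun u => r u v)) ∧
    ∀ u v, ι u v = log2E (r u v)

/-- The law `P_{S^e,S^d} P_{U,X|S^e} A_{Y|X}` of `(((S^e, S^d), (U, X)), Y)`. -/
def jointLaw {𝒮e 𝒮d 𝒰 𝒳 𝒴 : Type*} [MeasurableSpace 𝒮e] [MeasurableSpace 𝒮d]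
    [MeasurableSpace 𝒰] [MeasurableSpace 𝒳] [MeasurableSpace 𝒴]
    (P : Measure (𝒮e × 𝒮d)) (PUX : Kernel 𝒮e (𝒰 × 𝒳)) (A : Kernel 𝒳 𝒴) :
    Measure (((𝒮e × 𝒮d) × (𝒰 × 𝒳)) × 𝒴) :=
  (P ⊗ₘ PUX.comap Prod.fst measurable_fst) ⊗ₘ
    A.comap (fun p => p.2.2) (measurable_snd.comp measurable_snd)

/-- A scheme for the generalized information hiding problem with messages `[1 : L]`:
a (measurable) encoder `X = f(S^e, M)` and a (measurable) decoder `(M̂, X̂) = φ(S^d, Y)`. -/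
structure HidingScheme (𝒮e 𝒮d 𝒳 𝒴 : Type*) [MeasurableSpace 𝒮e] [MeasurableSpace 𝒮d]
    [MeasurableSpace 𝒳] [MeasurableSpace 𝒴] (L : ℕ) where
  enc : 𝒮e × Fin L → 𝒳
  dec : 𝒮d × 𝒴 → Fin L × 𝒳
  measurable_enc : Measurable enc
  measurable_dec : Measurable dec

namespace HidingScheme

variable {𝒮e 𝒮d 𝒳 𝒴 : Type*} [MeasurableSpace 𝒮e] [MeasurableSpace 𝒮d]
    [MeasurableSpace 𝒳] [MeasurableSpace 𝒴] {L : ℕ}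

/-- The law of `(((S^e, S^d), M), Y)` when `(S^e, S^d, M) ∼ P × Unif[1 : L]`, `X = f(S^e, M)` and
the attack channel is `A`. -/
def law (c : HidingScheme 𝒮e 𝒮d 𝒳 𝒴 L) (P : Measure (𝒮e × 𝒮d)) (A : Kernel 𝒳 𝒴) :
    Measure (((𝒮e × 𝒮d) × Fin L) × 𝒴) :=
  (P.prod (uniformOn (Set.univ : Set (Fin L)))) ⊗ₘ
    A.comap (fun p => c.enc (p.1.1, p.2))
      (c.measurable_enc.comp ((measurable_fst.comp measurable_fst).prodMk measurable_snd))

/-- The failure event `d₁(S^e, X) > D₁` or `d₂(X, X̂) > D₂` or `M ≠ M̂`. -/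
def failure (c : HidingScheme 𝒮e 𝒮d 𝒳 𝒴 L) (d₁ : 𝒮e → 𝒳 → ℝ≥0) (d₂ : 𝒳 → 𝒳 → ℝ≥0) (D₁ D₂ : ℝ) :
    Set (((𝒮e × 𝒮d) × Fin L) × 𝒴) :=
  {ω | let se := ω.1.1.1
       let sd := ω.1.1.2
       let m := ω.1.2
       let y := ω.2
       let x := c.enc (se, m)
       D₁ < d₁ se x ∨ D₂ < d₂ x (c.dec (sd, y)).2 ∨ m ≠ (c.dec (sd, y)).1}

/-- The worst-case failure probability `P_e` over the attack channels in `𝒜`. -/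
def failureProb (c : HidingScheme 𝒮e 𝒮d 𝒳 𝒴 L) (P : Measure (𝒮e × 𝒮d)) (𝒜 : Set (Kernel 𝒳 𝒴))
    (d₁ : 𝒮e → 𝒳 → ℝ≥0) (d₂ : 𝒳 → 𝒳 → ℝ≥0) (D₁ D₂ : ℝ) : ℝ≥0∞ :=
  ⨆ A ∈ 𝒜, c.law P A (c.failure d₁ d₂ D₁ D₂)

end HidingScheme

end

/-! Encoder and decoder share a random codebook: a Poisson process of points (arrival time, `u`,
label) with intensity Lebesgue × `P_U` × uniform. Each side selects the point minimising arrival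
time divided by its own weight. Knowing `S^e` and `M = m`, the encoder uses `L` times the density of
`P_{U|S^e}` on label `m` and zero on the other labels; the decoder uses the density of
`P̂_{U|Y,S^d}`, whatever the label. If both races have the same winner, the decoder reads off both
`M` and `U`.

A point of the process at time `t` and location `v` wins both races with probability at least
`exp(-t(1/w₁(v) + 1/w₂(v)))`, since its rivals in race `i` have intensity at most `t/wᵢ(v)`.
Integrating over `t` gives `(1/w₁ + 1/w₂)⁻¹` (`poisson_matching`), which for the weights above
becomes the density of `P_{U|S^e}` times `(1 + L·2^(ι - ι̂))⁻¹`. The input `X` is generated from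
`(S^e, U)` and a uniform variable that is part of the shared randomness. So for each attack the
failure probability averaged over codebooks is at most the expectation in the theorem
(`lintegral_failure_add_gain_le`). The decoder's weights only need total mass at most one, so `Â`
may differ from the true attack.

One codebook must serve all attacks. Summed over a minimal `ε`-cover, the averaged failure
probabilities are at most `N_ε` times the supremum, so some codebook does as well for the sum, hence
for each member of the cover. Any other attack costs at most `ε` more in total variation
(`HidingScheme.law_le_add_of_channelDist_le`). -/

noncomputable section

/-! ### Poisson processes from independent layers: void and Palm probabilities. -/

/-- The law of a Poisson point process with intensity the probability measure `ρ`: a number of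
points, and a sequence whose initial segment of that length lists the points. -/
def poissonLayer {E : Type*} [MeasurableSpace E] (ρ : Measure E) [IsProbabilityMeasure ρ] :
    Measure (ℕ × (ℕ → E)) :=
  (poissonMeasure 1).prod (Measure.infinitePi fun _ : ℕ => ρ)

instance {E : Type*} [MeasurableSpace E] (ρ : Measure E) [IsProbabilityMeasure ρ] :
    IsProbabilityMeasure (poissonLayer ρ) := by
  unfold poissonLayer; infer_instance

/-- The law of a Poisson point process with intensity `∑ k, ρ k`, listed layer by layer. -/
def poissonPointLaw {E : Type*} [MeasurableSpace E] (ρ : ℕ → Measure E)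
    [∀ k, IsProbabilityMeasure (ρ k)] : Measure (ℕ → ℕ × (ℕ → E)) :=
  Measure.infinitePi fun k => poissonLayer (ρ k)

instance {E : Type*} [MeasurableSpace E] (ρ : ℕ → Measure E) [∀ k, IsProbabilityMeasure (ρ k)] :
    IsProbabilityMeasure (poissonPointLaw ρ) := by
  unfold poissonPointLaw; infer_instance

section Layer

variable {E : Type*} [MeasurableSpace E]

lemma poissonMeasure_one_succ (n : ℕ) :
    poissonMeasure 1 {n + 1} * ((n + 1 : ℕ) : ℝ≥0∞) = poissonMeasure 1 {n} := by
  rw [poissonMeasure_singleton, poissonMeasure_singleton, ← ENNReal.ofReal_natCast,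
    ← ENNReal.ofReal_mul (by positivity)]
  congr 1
  rw [Nat.factorial_succ]
  push_cast
  have : (n.factorial : ℝ) ≠ 0 := by positivity
  field_simp
  simp

lemma tsum_poissonMeasure_one_mul_pow (b : ℝ) (hb : 0 ≤ b) :
    ∑' n, poissonMeasure 1 {n} * ENNReal.ofReal b ^ n = ENNReal.ofReal (Real.exp (b - 1)) := by
  have h : HasSum (fun n : ℕ => Real.exp (-1) * (b ^ n / n.factorial)) (Real.exp (b - 1)) := by
    have := (NormedSpace.expSeries_div_hasSum_exp b).mul_left (Real.exp (-1))
    rwa [← Real.exp_eq_exp_ℝ, ← Real.exp_add, neg_add_eq_sub] at this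
  rw [← h.tsum_eq, ENNReal.ofReal_tsum_of_nonneg (fun n => by positivity) h.summable]
  refine tsum_congr fun n => ?_
  rw [poissonMeasure_singleton, ← ENNReal.ofReal_pow hb, ← ENNReal.ofReal_mul (by positivity)]
  congr 1
  simp
  ring

lemma poissonLayer_apply (ρ : Measure E) [IsProbabilityMeasure ρ] {S : Set (ℕ × (ℕ → E))}
    (hS : MeasurableSet S) :
    poissonLayer ρ S = ∑' n, poissonMeasure 1 {n} *
      Measure.infinitePi (fun _ : ℕ => ρ) {f | (n, f) ∈ S} := by
  rw [poissonLayer, Measure.prod_apply hS, lintegral_countable']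
  exact tsum_congr fun n => mul_comm _ _

lemma measurableSet_forall_lt_mem {B : Set E} (hB : MeasurableSet B) :
    MeasurableSet {a : ℕ × (ℕ → E) | ∀ j < a.1, a.2 j ∈ B} := by
  have : {a : ℕ × (ℕ → E) | ∀ j < a.1, a.2 j ∈ B} =
      ⋂ j : ℕ, ({a | j < a.1}ᶜ ∪ {a | a.2 j ∈ B}) := by
    ext a; simp [imp_iff_not_or]
  rw [this]
  refine MeasurableSet.iInter fun j => .union (.compl ?_) ?_
  · exact measurable_fst (measurableSet_Ioi (a := j))
  · exact ((measurable_pi_apply j).comp measurable_snd) hB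

lemma measurableSet_lt_and_forall_lt_mem {B : Set E} (hB : MeasurableSet B) (i : ℕ) :
    MeasurableSet {a : ℕ × (ℕ → E) | i < a.1 ∧ ∀ j < a.1, j ≠ i → a.2 j ∈ B} := by
  have : {a : ℕ × (ℕ → E) | i < a.1 ∧ ∀ j < a.1, j ≠ i → a.2 j ∈ B} =
      {a | i < a.1} ∩ ⋂ j : ℕ, ({a | j < a.1}ᶜ ∪ ({a | j ≠ i}ᶜ ∪ {a | a.2 j ∈ B})) := by
    ext a; simp [imp_iff_not_or]
  rw [this]
  refine .inter (measurable_fst (measurableSet_Ioi (a := i))) <|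
    MeasurableSet.iInter fun j => .union (.compl ?_) (.union (.compl (.const _)) ?_)
  · exact measurable_fst (measurableSet_Ioi (a := j))
  · exact ((measurable_pi_apply j).comp measurable_snd) hB

lemma poissonLayer_void_eq_tsum (ρ : Measure E) [IsProbabilityMeasure ρ] {B : Set E}
    (hB : MeasurableSet B) :
    poissonLayer ρ {a | ∀ j < a.1, a.2 j ∈ B} = ∑' n, poissonMeasure 1 {n} * ρ B ^ n := by
  rw [poissonLayer_apply ρ (measurableSet_forall_lt_mem hB)]
  refine tsum_congr fun n => ?_
  have : {f : ℕ → E | (n, f) ∈ {a : ℕ × (ℕ → E) | ∀ j < a.1, a.2 j ∈ B}} =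
      Set.pi (Finset.range n) fun _ => B := by
    ext f; simp
  rw [this, Measure.infinitePi_pi _ (fun _ _ => hB)]
  simp

lemma poissonLayer_void (ρ : Measure E) [IsProbabilityMeasure ρ] {B : Set E}
    (hB : MeasurableSet B) :
    poissonLayer ρ {a | ∀ j < a.1, a.2 j ∈ B} = ENNReal.ofReal (Real.exp (-ρ.real Bᶜ)) := by
  rw [poissonLayer_void_eq_tsum ρ hB, ← ofReal_measureReal,
    tsum_poissonMeasure_one_mul_pow _ measureReal_nonneg, probReal_compl_eq_one_sub hB]
  simp

/-- Slivnyak's principle: seen from one of its points, the rest of a Poisson process is the same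
process again, so the sum equals the void probability. Given `n` points the sum is `n * ρ B ^ (n -
1)`, and the factor `n` shifts the Poisson weights by one (`poissonMeasure_one_succ`). -/
lemma tsum_poissonLayer_palm (ρ : Measure E) [IsProbabilityMeasure ρ] {B : Set E}
    (hB : MeasurableSet B) :
    ∑' i, poissonLayer ρ {a | i < a.1 ∧ ∀ j < a.1, j ≠ i → a.2 j ∈ B} =
      ENNReal.ofReal (Real.exp (-ρ.real Bᶜ)) := by
  have h (i n : ℕ) : Measure.infinitePi (fun _ : ℕ => ρ)
      {f | (n, f) ∈ {a : ℕ × (ℕ → E) | i < a.1 ∧ ∀ j < a.1, j ≠ i → a.2 j ∈ B}} =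
      if i < n then ρ B ^ (n - 1) else 0 := by
    split_ifs with hi
    · have : {f : ℕ → E | (n, f) ∈ {a : ℕ × (ℕ → E) | i < a.1 ∧ ∀ j < a.1, j ≠ i → a.2 j ∈ B}} =
          Set.pi ((Finset.range n).erase i) fun _ => B := by
        ext f
        simp only [Set.mem_ofPred_eq, hi, true_and, Set.mem_pi, Finset.coe_erase, Set.mem_sdiff,
          Finset.mem_coe, Finset.mem_range, Set.mem_singleton_iff, and_imp]
      rw [this, Measure.infinitePi_pi _ (fun _ _ => hB)]
      simp [Finset.card_erase_of_mem, hi]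
    · simp [hi]
  rw [← poissonLayer_void ρ hB, poissonLayer_void_eq_tsum ρ hB]
  simp_rw [poissonLayer_apply ρ (measurableSet_lt_and_forall_lt_mem hB _), h]
  rw [ENNReal.tsum_comm]
  have h2 (n : ℕ) : ∑' i, poissonMeasure 1 {n} * (if i < n then ρ B ^ (n - 1) else 0) =
      poissonMeasure 1 {n} * (n * ρ B ^ (n - 1)) := by
    rw [ENNReal.tsum_mul_left, tsum_eq_sum (s := Finset.range n)
        (fun i hi => if_neg (by simpa using hi)),
      Finset.sum_congr rfl (fun i hi => if_pos (Finset.mem_range.1 hi))]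
    simp
  simp_rw [h2]
  rw [tsum_eq_zero_add' ENNReal.summable]
  simp only [Nat.cast_zero, zero_mul, mul_zero, zero_add, Nat.add_sub_cancel]
  exact tsum_congr fun n => by rw [← mul_assoc, poissonMeasure_one_succ]

end Layer

/-! ### Redrawing one point leaves the process invariant. -/

section Resample

lemma measurePreserving_update_infinitePi {ι : Type*} [DecidableEq ι] {X : ι → Type*}
    [∀ i, MeasurableSpace (X i)] (μ : ∀ i, Measure (X i)) [∀ i, IsProbabilityMeasure (μ i)]
    (k : ι) :
    MeasurePreserving (fun p : (∀ i, X i) × X k => Function.update p.1 k p.2)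
      ((Measure.infinitePi μ).prod (μ k)) (Measure.infinitePi μ) := by
  have hm : Measurable fun p : (∀ i, X i) × X k => Function.update p.1 k p.2 := by
    refine measurable_pi_iff.2 fun i => ?_
    by_cases h : i = k
    · subst h; simpa using measurable_snd
    · simp only [Function.update_of_ne h]
      exact (measurable_pi_apply i).comp measurable_fst
  refine ⟨hm, Measure.eq_infinitePi _ fun s t ht => ?_⟩
  rw [Measure.map_apply hm (.pi s.countable_toSet fun i _ => ht i)]
  by_cases hk : k ∈ s
  · have : (fun p : (∀ i, X i) × X k => Function.update p.1 k p.2) ⁻¹' (Set.pi s t) =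
        (Set.pi (s.erase k) t) ×ˢ t k := by
      ext p
      simp only [Set.mem_preimage, Set.mem_pi, Set.mem_prod, Finset.coe_erase, Set.mem_sdiff,
        Finset.mem_coe, Set.mem_singleton_iff]
      constructor
      · intro h
        refine ⟨fun i hi => ?_, by simpa using h k hk⟩
        simpa [Function.update_of_ne hi.2] using h i hi.1
      · rintro ⟨h1, h2⟩ i hi
        by_cases h : i = k
        · subst h; simpa using h2
        · simpa [Function.update_of_ne h] using h1 i ⟨hi, h⟩
    rw [this, Measure.prod_prod, Measure.infinitePi_pi _ (fun i _ => ht i),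
      Finset.prod_erase_mul _ _ hk]
  · have : (fun p : (∀ i, X i) × X k => Function.update p.1 k p.2) ⁻¹' (Set.pi s t) =
        (Set.pi s t) ×ˢ Set.univ := by
      ext p
      simp only [Set.mem_preimage, Set.mem_pi, Set.mem_prod, Set.mem_univ, and_true]
      refine forall₂_congr fun i hi => ?_
      rw [Function.update_of_ne (by rintro rfl; exact hk hi)]
    rw [this, Measure.prod_prod, Measure.infinitePi_pi _ (fun i _ => ht i)]
    simp

variable {E : Type*}

/-- Replace the `p.2`-th point of layer `p.1` by `e`. -/
def replacePoint (ω : ℕ → ℕ × (ℕ → E)) (p : ℕ × ℕ) (e : E) : ℕ → ℕ × (ℕ → E) :=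
  Function.update ω p.1 ((ω p.1).1, Function.update (ω p.1).2 p.2 e)

lemma replacePoint_fst (ω : ℕ → ℕ × (ℕ → E)) (p : ℕ × ℕ) (e : E) (k : ℕ) :
    (replacePoint ω p e k).1 = (ω k).1 := by
  unfold replacePoint
  by_cases h : k = p.1
  · subst h; simp
  · rw [Function.update_of_ne h]

lemma replacePoint_same (ω : ℕ → ℕ × (ℕ → E)) (p : ℕ × ℕ) (e : E) :
    (replacePoint ω p e p.1).2 p.2 = e := by
  simp [replacePoint]

lemma replacePoint_of_ne (ω : ℕ → ℕ × (ℕ → E)) (p : ℕ × ℕ) (e : E) {q : ℕ × ℕ} (h : q ≠ p) :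
    (replacePoint ω p e q.1).2 q.2 = (ω q.1).2 q.2 := by
  unfold replacePoint
  by_cases h1 : q.1 = p.1
  · rw [h1]
    have : q.2 ≠ p.2 := fun h2 => h (Prod.ext h1 h2)
    simp [Function.update_of_ne this]
  · rw [Function.update_of_ne h1]

/-- Slot `p.2` of layer `p.1` is independent of all counts and all other slots, so a fresh copy may
take its place. The slot is redrawn even when it lies beyond the count, which keeps the statement
unconditional. -/
lemma measurePreserving_replacePoint [MeasurableSpace E] (ρ : ℕ → Measure E)
    [∀ k, IsProbabilityMeasure (ρ k)]
    (p : ℕ × ℕ) :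
    MeasurePreserving (fun a : (ℕ → ℕ × (ℕ → E)) × E => replacePoint a.1 p a.2)
      ((poissonPointLaw ρ).prod (ρ p.1)) (poissonPointLaw ρ) := by
  obtain ⟨k, i⟩ := p
  have h1 := measurePreserving_update_infinitePi (fun k => poissonLayer (ρ k)) k
  have h2 : MeasurePreserving (fun a : (ℕ × (ℕ → E)) × E => (a.1.1, Function.update a.1.2 i a.2))
      ((poissonLayer (ρ k)).prod (ρ k)) (poissonLayer (ρ k)) := by
    have h3 := measurePreserving_update_infinitePi (fun _ : ℕ => ρ k) i
    exact ((MeasurePreserving.id (poissonMeasure 1)).prod h3).comp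
      (measurePreserving_prodAssoc (poissonMeasure 1) (Measure.infinitePi fun _ : ℕ => ρ k) (ρ k))
  have hm : Measurable fun a : (ℕ → ℕ × (ℕ → E)) × E => replacePoint a.1 (k, i) a.2 := by
    have e1 : Measurable fun a : (ℕ → ℕ × (ℕ → E)) × E => (a.1, ((a.1 k), a.2)) := by fun_prop
    exact h1.measurable.comp ((measurable_fst).prodMk (h2.measurable.comp (e1.snd)))
  refine ⟨hm, ?_⟩
  ext S hS
  rw [Measure.map_apply hm hS]
  have hr : ∀ (ω : ℕ → ℕ × (ℕ → E)) (a : ℕ × (ℕ → E)) (e : E),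
      replacePoint (Function.update ω k a) (k, i) e =
        Function.update ω k (a.1, Function.update a.2 i e) := by
    intro ω a e; simp [replacePoint]
  -- Redrawing the whole layer `k` first reduces the claim to the invariance `h2` of a single layer.
  have key : ∀ f : (ℕ → ℕ × (ℕ → E)) → ℝ≥0∞, Measurable f →
      ∫⁻ ω, f ω ∂(poissonPointLaw ρ) =
        ∫⁻ ω, ∫⁻ a, f (Function.update ω k a) ∂(poissonLayer (ρ k)) ∂(poissonPointLaw ρ) := by
    intro f hf
    unfold poissonPointLaw
    have e1 := h1.lintegral_comp hf
    have e2 := lintegral_prod (μ := Measure.infinitePi fun k => poissonLayer (ρ k))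
      (ν := poissonLayer (ρ k)) _ (hf.comp h1.measurable).aemeasurable
    exact e1.symm.trans e2
  have hM : Measurable fun ω => ρ k {e | replacePoint ω (k, i) e ∈ S} :=
    measurable_measure_prodMk_left (hm hS)
  calc _ = ∫⁻ ω, ρ k {e | replacePoint ω (k, i) e ∈ S} ∂(poissonPointLaw ρ) := by
        rw [Measure.prod_apply (hm hS)]; rfl
    _ = ∫⁻ ω, ∫⁻ a, ρ k {e | Function.update ω k (a.1, Function.update a.2 i e) ∈ S}
          ∂(poissonLayer (ρ k)) ∂(poissonPointLaw ρ) := by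
        rw [key _ hM]
        simp_rw [hr]
    _ = ∫⁻ ω, ∫⁻ a, S.indicator (fun _ => (1 : ℝ≥0∞)) (Function.update ω k a)
          ∂(poissonLayer (ρ k)) ∂(poissonPointLaw ρ) := by
        refine lintegral_congr fun ω => ?_
        have hu : Measurable fun a : ℕ × (ℕ → E) => Function.update ω k a :=
          h1.measurable.comp measurable_prodMk_left
        have hi : Measurable fun a => S.indicator (fun _ => (1 : ℝ≥0∞)) (Function.update ω k a) :=
          (measurable_const.indicator hS).comp hu
        refine Eq.trans ?_ ((lintegral_prod _ (hi.comp h2.measurable).aemeasurable).symm.trans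
          (h2.lintegral_comp hi))
        refine lintegral_congr fun a => ?_
        have hs : MeasurableSet {e | Function.update ω k (a.1, Function.update a.2 i e) ∈ S} :=
          (hu.comp (h2.measurable.comp measurable_prodMk_left)) hS
        rw [← lintegral_indicator_one hs]
        rfl
    _ = _ := by
        rw [← key _ (measurable_const.indicator hS)]
        exact lintegral_indicator_one hS

end Resample

/-! ### A Campbell–Mecke inequality for points that avoid a forbidden region. -/

section Palm

/-- The event that the point `p` of the process is present, and that no other point that is
present lies in the forbidden region `R` attached to a location `a.2`. -/
def avoidEvent {E Y : Type*} (R : Set ((E × Y) × E)) (p : ℕ × ℕ) :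
    Set ((ℕ → ℕ × (ℕ → E)) × (E × Y)) :=
  {a | p.2 < (a.1 p.1).1 ∧
    ∀ q : ℕ × ℕ, q.2 < (a.1 q.1).1 → q ≠ p → (a.2, (a.1 q.1).2 q.2) ∉ R}

/-- The event constrains only the presence of `p` and the other points; the region is attached to
the separate variable `z`. Hence the location of `p` can be redrawn independently of the event. -/
lemma replacePoint_mem_avoidEvent_iff {E Y : Type*} (R : Set ((E × Y) × E)) (p : ℕ × ℕ)
    (ω : ℕ → ℕ × (ℕ → E)) (e : E) (z : E × Y) :
    (replacePoint ω p e, z) ∈ avoidEvent R p ↔ (ω, z) ∈ avoidEvent R p := by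
  simp only [avoidEvent, Set.mem_ofPred_eq, replacePoint_fst]
  refine and_congr_right fun _ => forall_congr' fun q => forall₂_congr fun _ hq => ?_
  rw [replacePoint_of_ne ω p e hq]

variable {E Y : Type*} [MeasurableSpace E] [MeasurableSpace Y]

/-- Layers are independent: layer `k` contributes its Palm sum and every other layer its void
probability, and both equal `exp(-ρ l Bᶜ)` for the layer `l` in question. The product over all
layers is at least `exp(-c)`. -/
lemma exp_neg_le_tsum_poissonPointLaw_avoid (ρ : ℕ → Measure E) [∀ k, IsProbabilityMeasure (ρ k)]
    {B : Set E} (hB : MeasurableSet B) (c : ℝ≥0) (hc : ∑' k, ρ k Bᶜ ≤ c) (k : ℕ) :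
    ENNReal.ofReal (Real.exp (-c)) ≤ ∑' i, poissonPointLaw ρ
      {ω | i < (ω k).1 ∧ ∀ q : ℕ × ℕ, q.2 < (ω q.1).1 → q ≠ (k, i) → (ω q.1).2 q.2 ∈ B} := by
  set S : ℕ → Set (ℕ × (ℕ → E)) := fun i => {a | i < a.1 ∧ ∀ j < a.1, j ≠ i → a.2 j ∈ B} with hS
  set V : Set (ℕ × (ℕ → E)) := {a | ∀ j < a.1, a.2 j ∈ B} with hV
  set v : ℕ → ℝ≥0∞ := fun k => ENNReal.ofReal (Real.exp (-(ρ k).real Bᶜ)) with hv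
  have hvoid : ∀ k, poissonLayer (ρ k) V = v k := fun k => poissonLayer_void (ρ k) hB
  have hSm : ∀ i, MeasurableSet (S i) := fun i => measurableSet_lt_and_forall_lt_mem hB i
  have hVm : MeasurableSet V := measurableSet_forall_lt_mem hB
  have hset (i : ℕ) :
      {ω : ℕ → ℕ × (ℕ → E) |
        i < (ω k).1 ∧ ∀ q : ℕ × ℕ, q.2 < (ω q.1).1 → q ≠ (k, i) → (ω q.1).2 q.2 ∈ B} =
      Set.univ.pi fun l => if l = k then S i else V := by
    ext ω
    simp only [Set.mem_ofPred_eq, Set.mem_pi, Set.mem_univ, true_imp_iff]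
    constructor
    · rintro ⟨h1, h2⟩ l
      split_ifs with hl
      · subst hl
        exact ⟨h1, fun j hj hji => h2 (l, j) hj (by simpa using hji)⟩
      · exact fun j hj => h2 (l, j) hj (by simp [hl])
    · intro h
      have hk := h k
      rw [if_pos rfl] at hk
      refine ⟨hk.1, fun q hq hne => ?_⟩
      by_cases hl : q.1 = k
      · have := hk.2 q.2 (hl ▸ hq) (fun h => hne (Prod.ext hl h))
        rwa [← hl] at this
      · have := h q.1
        rw [if_neg hl] at this
        exact this q.2 hq
  have hprod (s : Finset ℕ) : ENNReal.ofReal (Real.exp (-c)) ≤ ∏ l ∈ s, v l := by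
    rw [← ENNReal.ofReal_prod_of_nonneg (fun _ _ => (Real.exp_pos _).le), ← Real.exp_sum]
    refine ENNReal.ofReal_le_ofReal (Real.exp_le_exp.2 ?_)
    rw [Finset.sum_neg_distrib, neg_le_neg_iff]
    have h1 : ∑ l ∈ s, ρ l Bᶜ ≤ c := (ENNReal.sum_le_tsum s).trans hc
    have h2 := ENNReal.toReal_mono ENNReal.coe_ne_top h1
    rwa [ENNReal.toReal_sum (fun _ _ => measure_ne_top _ _)] at h2
  have hv0 : v k ≠ 0 := by simp [hv, Real.exp_pos]
  have hvt : v k ≠ ∞ := by simp [hv]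
  -- The infinite product is an infimum of finite ones. The extra factor `v k` completes the void
  -- probabilities to a product over all of `insert k s`; it cancels after summing over `i`, because
  -- the Palm sum is again `v k`.
  have hclaim (i : ℕ) : poissonLayer (ρ k) (S i) * ENNReal.ofReal (Real.exp (-c)) ≤
      v k * poissonPointLaw ρ (Set.univ.pi fun l => if l = k then S i else V) := by
    have hm : ∀ l, MeasurableSet (if l = k then S i else V) := by
      intro l; split_ifs; exacts [hSm i, hVm]
    rw [poissonPointLaw, Measure.infinitePi_pi_univ _ hm,
      ENNReal.tprod_eq_iInf_prod (fun _ => prob_le_one),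
      ENNReal.mul_iInf_of_ne hv0 hvt]
    refine le_iInf fun s => ?_
    calc poissonLayer (ρ k) (S i) * ENNReal.ofReal (Real.exp (-c))
        ≤ poissonLayer (ρ k) (S i) * ∏ l ∈ insert k s, v l := by gcongr; exact hprod _
      _ = v k * ∏ l ∈ insert k s, poissonLayer (ρ l) (if l = k then S i else V) := by
          rw [← Finset.mul_prod_erase _ _ (Finset.mem_insert_self k s),
            ← Finset.mul_prod_erase _ _ (Finset.mem_insert_self k s), if_pos rfl]
          have hpe : ∏ l ∈ (insert k s).erase k, poissonLayer (ρ l) (if l = k then S i else V) =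
              ∏ l ∈ (insert k s).erase k, v l :=
            Finset.prod_congr rfl fun l hl => by rw [if_neg (Finset.ne_of_mem_erase hl), hvoid]
          rw [hpe]
          ring
      _ ≤ _ := by
          refine mul_le_mul_right (Finset.prod_le_prod_of_subset_of_le_one'
            (Finset.subset_insert k s) (fun _ _ _ => prob_le_one)) _
  have hsum := ENNReal.tsum_le_tsum hclaim
  rw [ENNReal.tsum_mul_right, tsum_poissonLayer_palm (ρ k) hB, ENNReal.tsum_mul_left] at hsum
  simp_rw [hset]
  exact (ENNReal.mul_le_mul_iff_right hv0 hvt).1 hsum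

lemma measurableSet_avoidEvent {R : Set ((E × Y) × E)} (hR : MeasurableSet R) (p : ℕ × ℕ) :
    MeasurableSet (avoidEvent R p) := by
  have hpres (q : ℕ × ℕ) :
      MeasurableSet {a : (ℕ → ℕ × (ℕ → E)) × (E × Y) | q.2 < (a.1 q.1).1} :=
    ((measurable_pi_apply q.1).comp measurable_fst).fst (measurableSet_Ioi (a := q.2))
  have : avoidEvent R p = {a | p.2 < (a.1 p.1).1} ∩ ⋂ q : ℕ × ℕ, ({a | q.2 < (a.1 q.1).1}ᶜ ∪
      ({a | q ≠ p}ᶜ ∪ {a | (a.2, (a.1 q.1).2 q.2) ∈ R}ᶜ)) := by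
    ext a; simp [avoidEvent, imp_iff_not_or]
  rw [this]
  refine .inter (hpres p) <| MeasurableSet.iInter fun q =>
    .union (hpres q).compl (.union (.compl (.const _)) (.compl ?_))
  have : Measurable fun a : (ℕ → ℕ × (ℕ → E)) × (E × Y) => (a.2, (a.1 q.1).2 q.2) := by fun_prop
  exact this hR

/-- The expected sum over the points of the process is an integral against the intensity, where the
remaining points behave like the original process and avoid the region with probability at least
`exp(-c)`. The mark `y`, drawn from `K` at the point, will be the channel output. -/
theorem tsum_lintegral_exp_neg_le_poissonPointLaw (ρ : ℕ → Measure E)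
    [∀ k, IsProbabilityMeasure (ρ k)]
    (K : Kernel E Y) [IsSFiniteKernel K] (F : E × Y → ℝ≥0∞) (hF : Measurable F)
    (R : Set ((E × Y) × E)) (hR : MeasurableSet R) (c : E × Y → ℝ≥0)
    (hc : ∀ z, F z ≠ 0 → ∑' k, ρ k {e | (z, e) ∈ R} ≤ c z) :
    ∑' k, ∫⁻ e, ∫⁻ y, F (e, y) * ENNReal.ofReal (Real.exp (-c (e, y))) ∂K e ∂ρ k ≤
      ∫⁻ ω, ∑' p : ℕ × ℕ, ∫⁻ y, (avoidEvent R p).indicator (fun a => F a.2)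
        (ω, ((ω p.1).2 p.2, y)) ∂K ((ω p.1).2 p.2) ∂poissonPointLaw ρ := by
  have hGm (p) : Measurable ((avoidEvent R p).indicator (fun a => F a.2)) :=
    (hF.comp measurable_snd).indicator (measurableSet_avoidEvent hR p)
  set H : ℕ × ℕ → (ℕ → ℕ × (ℕ → E)) × E → ℝ≥0∞ := fun p a =>
    ∫⁻ y, (avoidEvent R p).indicator (fun a => F a.2) (a.1, (a.2, y)) ∂K a.2 with hH
  have hHm (p) : Measurable (H p) := by
    have h1 : Measurable fun b : ((ℕ → ℕ × (ℕ → E)) × E) × Y =>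
        (avoidEvent R p).indicator (fun a => F a.2) (b.1.1, (b.1.2, b.2)) :=
      (hGm p).comp (by fun_prop)
    exact h1.lintegral_kernel_prod_right' (κ := K.comap Prod.snd measurable_snd)
  have hpt (p : ℕ × ℕ) : Measurable fun ω : ℕ → ℕ × (ℕ → E) => (ω, (ω p.1).2 p.2) := by fun_prop
  have hswap : ∫⁻ ω, ∑' p : ℕ × ℕ, H p (ω, (ω p.1).2 p.2) ∂poissonPointLaw ρ =
      ∑' p : ℕ × ℕ, ∫⁻ ω, H p (ω, (ω p.1).2 p.2) ∂poissonPointLaw ρ :=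
    lintegral_tsum (fun p => ((hHm p).comp (hpt p)).aemeasurable)
  -- With the location of `p` redrawn as an independent `e`, the event no longer involves it and
  -- Tonelli applies.
  have hres (p : ℕ × ℕ) : ∫⁻ ω, H p (ω, (ω p.1).2 p.2) ∂poissonPointLaw ρ =
      ∫⁻ e, ∫⁻ y, F (e, y) * poissonPointLaw ρ {ω | (ω, (e, y)) ∈ avoidEvent R p} ∂K e
        ∂ρ p.1 := by
    have hmp := measurePreserving_replacePoint ρ p
    have e1 := hmp.lintegral_comp ((hHm p).comp (hpt p))
    have e2 := lintegral_prod_symm (μ := poissonPointLaw ρ) (ν := ρ p.1) _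
      (((hHm p).comp (hpt p)).comp hmp.measurable).aemeasurable
    refine e1.symm.trans (e2.trans ?_)
    refine lintegral_congr fun e => ?_
    simp only [Function.comp_apply, replacePoint_same, hH]
    have hinv (ω : ℕ → ℕ × (ℕ → E)) (y : Y) :
        (avoidEvent R p).indicator (fun a => F a.2) (replacePoint ω p e, (e, y)) =
        (avoidEvent R p).indicator (fun a => F a.2) (ω, (e, y)) := by
      by_cases h : (ω, (e, y)) ∈ avoidEvent R p
      · rw [Set.indicator_of_mem h,
          Set.indicator_of_mem ((replacePoint_mem_avoidEvent_iff R p ω e _).2 h)]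
      · rw [Set.indicator_of_notMem h,
          Set.indicator_of_notMem (fun h' => h ((replacePoint_mem_avoidEvent_iff R p ω e _).1 h'))]
    simp_rw [hinv]
    have hme : Measurable fun a : (ℕ → ℕ × (ℕ → E)) × Y => (a.1, (e, a.2)) := by fun_prop
    rw [lintegral_lintegral_swap (f := fun ω y =>
      (avoidEvent R p).indicator (fun a => F a.2) (ω, (e, y))) ((hGm p).comp hme).aemeasurable]
    refine lintegral_congr fun y => ?_
    have hs : MeasurableSet {ω | (ω, (e, y)) ∈ avoidEvent R p} :=
      measurable_prodMk_right (measurableSet_avoidEvent hR p)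
    rw [← lintegral_indicator_const hs]
    rfl
  calc _ ≤ ∑' k, ∑' i, ∫⁻ ω, H (k, i) (ω, (ω k).2 i) ∂poissonPointLaw ρ := by
        refine ENNReal.tsum_le_tsum fun k => ?_
        simp_rw [fun i => hres (k, i)]
        have hPm (i : ℕ) : Measurable fun z : E × Y =>
            F z * poissonPointLaw ρ {ω | (ω, z) ∈ avoidEvent R (k, i)} :=
          hF.mul (measurable_measure_prodMk_right (measurableSet_avoidEvent hR (k, i)))
        rw [← lintegral_tsum (fun i => ?_)]
        swap
        · exact ((hPm i).lintegral_kernel_prod_right').aemeasurable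
        refine lintegral_mono fun e => ?_
        rw [← lintegral_tsum (f := fun i y =>
          F (e, y) * poissonPointLaw ρ {ω | (ω, (e, y)) ∈ avoidEvent R (k, i)})
          (fun i => ((hPm i).comp measurable_prodMk_left).aemeasurable)]
        refine lintegral_mono fun y => ?_
        simp only
        rw [ENNReal.tsum_mul_left]
        by_cases h0 : F (e, y) = 0
        · simp [h0]
        gcongr
        have hB : MeasurableSet {e' | ((e, y), e') ∈ R} := measurable_prodMk_left hR
        have := exp_neg_le_tsum_poissonPointLaw_avoid ρ hB.compl (c (e, y))
          (by rw [compl_compl]; exact hc _ h0) k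
        exact this
    _ = ∑' p : ℕ × ℕ, ∫⁻ ω, H p (ω, (ω p.1).2 p.2) ∂poissonPointLaw ρ :=
        (ENNReal.tsum_prod' (f := fun p : ℕ × ℕ =>
          ∫⁻ ω, H p (ω, (ω p.1).2 p.2) ∂poissonPointLaw ρ)).symm
    _ = _ := hswap.symm

end Palm

/-! ### Races on a Poisson process and the Poisson matching lemma. -/

section Race

/-- The point `p` is the winner of the race with weights `w`: it is the unique point of the process
that minimizes the ratio of the arrival time to the weight. -/
def Wins {V : Type*} (ω : ℕ → ℕ × (ℕ → ℝ × V)) (w : V → ℝ≥0) (p : ℕ × ℕ) : Prop :=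
  p.2 < (ω p.1).1 ∧ ∀ q : ℕ × ℕ, q.2 < (ω q.1).1 → q ≠ p →
    ((ω p.1).2 p.2).1 * w ((ω q.1).2 q.2).2 < ((ω q.1).2 q.2).1 * w ((ω p.1).2 p.2).2

lemma Wins.unique {V : Type*} {ω : ℕ → ℕ × (ℕ → ℝ × V)} {w : V → ℝ≥0} {p q : ℕ × ℕ}
    (hp : Wins ω w p) (hq : Wins ω w q) : p = q := by
  by_contra h
  exact lt_asymm (hp.2 q hq.1 (Ne.symm h)) (hq.2 p hp.1 h)

open Classical in
/-- The location of the winner of the race with weights `w`, and `v₀` if there is no winner. -/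
def winner {V : Type*} (v₀ : V) (ω : ℕ → ℕ × (ℕ → ℝ × V)) (w : V → ℝ≥0) : V :=
  if h : ∃ p, Wins ω w p then ((ω h.choose.1).2 h.choose.2).2 else v₀

lemma Wins.winner_eq {V : Type*} {v₀ : V} {ω : ℕ → ℕ × (ℕ → ℝ × V)} {w : V → ℝ≥0} {p : ℕ × ℕ}
    (hp : Wins ω w p) : winner v₀ ω w = ((ω p.1).2 p.2).2 := by
  have h : ∃ p, Wins ω w p := ⟨p, hp⟩
  rw [winner, dif_pos h, h.choose_spec.unique hp]

variable {V Y : Type*} [MeasurableSpace V] [MeasurableSpace Y]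

lemma measurableSet_wins {Θ : Type*} [MeasurableSpace Θ] {w : Θ → V → ℝ≥0}
    (hw : Measurable (Function.uncurry w)) (p : ℕ × ℕ) :
    MeasurableSet {a : (ℕ → ℕ × (ℕ → ℝ × V)) × Θ | Wins a.1 (w a.2) p} := by
  have hpres (q : ℕ × ℕ) :
      MeasurableSet {a : (ℕ → ℕ × (ℕ → ℝ × V)) × Θ | q.2 < (a.1 q.1).1} :=
    ((measurable_pi_apply q.1).comp measurable_fst).fst (measurableSet_Ioi (a := q.2))
  have hpt (q : ℕ × ℕ) :
      Measurable fun a : (ℕ → ℕ × (ℕ → ℝ × V)) × Θ => (a.1 q.1).2 q.2 := by fun_prop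
  have hwq (q : ℕ × ℕ) :
      Measurable fun a : (ℕ → ℕ × (ℕ → ℝ × V)) × Θ => ((w a.2 ((a.1 q.1).2 q.2).2 : ℝ≥0) : ℝ) :=
    (hw.comp (measurable_snd.prodMk (hpt q).snd)).coe_nnreal_real
  have : {a : (ℕ → ℕ × (ℕ → ℝ × V)) × Θ | Wins a.1 (w a.2) p} =
      {a | p.2 < (a.1 p.1).1} ∩ ⋂ q : ℕ × ℕ, ({a | q.2 < (a.1 q.1).1}ᶜ ∪
      ({a | q ≠ p}ᶜ ∪ {a | ((a.1 p.1).2 p.2).1 * (w a.2 ((a.1 q.1).2 q.2).2 : ℝ) <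
        ((a.1 q.1).2 q.2).1 * (w a.2 ((a.1 p.1).2 p.2).2 : ℝ)})) := by
    ext a; simp [Wins, imp_iff_not_or]
  rw [this]
  exact .inter (hpres p) <| MeasurableSet.iInter fun q =>
    .union (hpres q).compl (.union (.compl (.const _))
      (measurableSet_lt ((hpt p).fst.mul (hwq q)) ((hpt q).fst.mul (hwq p))))

lemma measurable_winner (v₀ : V) {Θ : Type*} [MeasurableSpace Θ] {w : Θ → V → ℝ≥0}
    (hw : Measurable (Function.uncurry w)) :
    Measurable fun a : (ℕ → ℕ × (ℕ → ℝ × V)) × Θ => winner v₀ a.1 (w a.2) := by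
  intro B hB
  have : (fun a : (ℕ → ℕ × (ℕ → ℝ × V)) × Θ => winner v₀ a.1 (w a.2)) ⁻¹' B =
      (⋃ p : ℕ × ℕ, ({a | Wins a.1 (w a.2) p} ∩ {a | ((a.1 p.1).2 p.2).2 ∈ B})) ∪
      ((⋃ p : ℕ × ℕ, {a | Wins a.1 (w a.2) p})ᶜ ∩ {a | v₀ ∈ B}) := by
    ext a
    by_cases h : ∃ p, Wins a.1 (w a.2) p
    · obtain ⟨p, hp⟩ := h
      simp only [Set.mem_preimage, hp.winner_eq, Set.mem_union, Set.mem_iUnion, Set.mem_inter_iff,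
        Set.mem_ofPred_eq, Set.mem_compl_iff]
      constructor
      · exact fun h => .inl ⟨p, hp, h⟩
      · rintro (⟨q, hq, h⟩ | ⟨h, -⟩)
        · rwa [hp.unique hq]
        · exact absurd ⟨p, hp⟩ h
    · have hw : winner v₀ a.1 (w a.2) = v₀ := by rw [winner, dif_neg h]
      push Not at h
      simp [hw, h]
  rw [this]
  have hpt (q : ℕ × ℕ) :
      Measurable fun a : (ℕ → ℕ × (ℕ → ℝ × V)) × Θ => ((a.1 q.1).2 q.2).2 := by fun_prop
  exact .union (.iUnion fun p => .inter (measurableSet_wins hw p) (hpt p hB))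
    (.inter (MeasurableSet.iUnion fun p => measurableSet_wins hw p).compl (.const _))

/-- The intensity of the points that arrive in the time interval `[k, k + 1)`. -/
def raceLayer (ν : Measure V) (k : ℕ) : Measure (ℝ × V) :=
  (volume.restrict (Set.Ico (k : ℝ) (k + 1))).prod ν

instance (ν : Measure V) [IsProbabilityMeasure ν] (k : ℕ) :
    IsProbabilityMeasure (raceLayer ν k) := by
  have : IsProbabilityMeasure (volume.restrict (Set.Ico (k : ℝ) (k + 1))) := ⟨by simp⟩
  unfold raceLayer; infer_instance

/-- The unit time intervals tile the half-line, so the infinite intensity Lebesgue × `ν` splits into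
the probability layers required by `poissonPointLaw`. -/
lemma sum_raceLayer (ν : Measure V) [IsProbabilityMeasure ν] :
    Measure.sum (raceLayer ν) = (volume.restrict (Set.Ici (0 : ℝ))).prod ν := by
  have h : ⋃ k : ℕ, Set.Ico (k : ℝ) (k + 1) = Set.Ici 0 := by
    ext x
    simp only [Set.mem_iUnion, Set.mem_Ico, Set.mem_Ici]
    exact ⟨fun ⟨k, hk, _⟩ => (Nat.cast_nonneg k).trans hk,
      fun hx => ⟨⌊x⌋₊, Nat.floor_le hx, Nat.lt_floor_add_one x⟩⟩
  have hd : Pairwise (Function.onFun Disjoint fun k : ℕ => Set.Ico (k : ℝ) (k + 1)) := by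
    intro i j hij
    refine Set.disjoint_left.2 fun x hx hy => hij ?_
    have h1 : (i : ℝ) < j + 1 := hx.1.trans_lt hy.2
    have h2 : (j : ℝ) < i + 1 := hy.1.trans_lt hx.2
    norm_cast at h1 h2
    omega
  rw [← h, Measure.restrict_iUnion hd (fun _ => measurableSet_Ico), Measure.prod_sum_left]
  rfl

/-- The exponential density of rate `a` has total mass one. -/
lemma lintegral_exp_neg_mul_Ici (a : ℝ≥0) (ha : 0 < a) :
    ∫⁻ t in Set.Ici (0 : ℝ), ENNReal.ofReal (Real.exp (-(t.toNNReal * a : ℝ≥0))) =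
      (a : ℝ≥0∞)⁻¹ := by
  have h1 := lintegral_exponentialPDF_eq_one (r := a) (by exact_mod_cast ha)
  have h2 : ∫⁻ x, exponentialPDF a x =
      a * ∫⁻ t in Set.Ici (0 : ℝ), ENNReal.ofReal (Real.exp (-(t.toNNReal * a : ℝ≥0))) := by
    rw [← lintegral_const_mul' _ _ ENNReal.coe_ne_top, ← lintegral_indicator measurableSet_Ici]
    refine lintegral_congr fun x => ?_
    rw [exponentialPDF_eq]
    by_cases hx : 0 ≤ x
    · rw [if_pos hx, Set.indicator_of_mem (Set.mem_Ici.2 hx),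
        ENNReal.ofReal_mul (NNReal.coe_nonneg a),
        ENNReal.ofReal_coe_nnreal]
      congr 4
      simp [hx, mul_comm]
    · rw [if_neg hx, Set.indicator_of_notMem (by simpa using hx), ENNReal.ofReal_zero]
  rw [h2] at h1
  exact (ENNReal.eq_inv_of_mul_eq_one_left (by rwa [mul_comm] at h1))

/-- The locations that would beat (or tie with) a given point in one of two races. -/
def raceRegion (w₁ : V → ℝ≥0) (w₂ : Y → V → ℝ≥0) : Set (((ℝ × V) × Y) × (ℝ × V)) :=
  {b | b.2.1 * w₁ b.1.1.2 ≤ b.1.1.1 * w₁ b.2.2 ∨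
    b.2.1 * w₂ b.1.2 b.1.1.2 ≤ b.1.1.1 * w₂ b.1.2 b.2.2}

lemma measurableSet_raceRegion {w₁ : V → ℝ≥0} (hw₁ : Measurable w₁) {w₂ : Y → V → ℝ≥0}
    (hw₂ : Measurable (Function.uncurry w₂)) : MeasurableSet (raceRegion w₁ w₂) := by
  have h2 {f : ((ℝ × V) × Y) × (ℝ × V) → V} (hf : Measurable f) :
      Measurable fun b : ((ℝ × V) × Y) × (ℝ × V) => ((w₂ b.1.2 (f b) : ℝ≥0) : ℝ) :=
    (hw₂.comp (measurable_fst.snd.prodMk hf)).coe_nnreal_real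
  refine MeasurableSet.union
    (s₁ := {b : ((ℝ × V) × Y) × (ℝ × V) | b.2.1 * (w₁ b.1.1.2 : ℝ) ≤ b.1.1.1 * (w₁ b.2.2 : ℝ)})
    (s₂ := {b | b.2.1 * (w₂ b.1.2 b.1.1.2 : ℝ) ≤ b.1.1.1 * (w₂ b.1.2 b.2.2 : ℝ)})
    (measurableSet_le ?_ ?_) (measurableSet_le ?_ ?_)
  · exact measurable_snd.fst.mul (hw₁.comp measurable_fst.fst.snd).coe_nnreal_real
  · exact measurable_fst.fst.fst.mul (hw₁.comp measurable_snd.snd).coe_nnreal_real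
  · exact measurable_snd.fst.mul (h2 measurable_fst.fst.snd)
  · exact measurable_fst.fst.fst.mul (h2 measurable_snd.snd)

lemma volume_setOf_mul_le (t : ℝ) (ht : 0 ≤ t) (a b : ℝ≥0) (ha : 0 < a) :
    volume.restrict (Set.Ici (0 : ℝ)) {s | s * a ≤ t * b} ≤ (t.toNNReal * a⁻¹ : ℝ≥0) * b := by
  rw [Measure.restrict_apply (measurableSet_le (by fun_prop) (by fun_prop))]
  have h : {s : ℝ | s * a ≤ t * b} ∩ Set.Ici 0 ⊆ Set.Icc 0 (t * b / a) := by
    rintro s ⟨hs, h0⟩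
    exact ⟨h0, (le_div_iff₀ (by exact_mod_cast ha)).2 hs⟩
  refine (measure_mono h).trans ?_
  rw [Real.volume_Icc, sub_zero, ← ENNReal.coe_mul, ENNReal.ofReal]
  refine ENNReal.coe_le_coe.2 (le_of_eq ?_)
  lift t to ℝ≥0 using ht
  rw [← NNReal.coe_mul, ← NNReal.coe_div, Real.toNNReal_coe, Real.toNNReal_coe]
  rw [div_eq_mul_inv]; ring

/-- In the race with weights `w`, a rival at `v'` beats or ties with `(t, v)` only if it arrives by
time `t * w v' / w v`. Integrating over `v'`, with total weight at most one, gives `t / w v`; a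
union bound adds the two races. -/
lemma tsum_raceLayer_raceRegion_le (ν : Measure V) [IsProbabilityMeasure ν]
    {w₁ : V → ℝ≥0} (hw₁ : Measurable w₁) (hI₁ : ∫⁻ v, w₁ v ∂ν ≤ 1)
    {w₂ : Y → V → ℝ≥0} (hw₂ : Measurable (Function.uncurry w₂)) (hI₂ : ∀ y, ∫⁻ v, w₂ y v ∂ν ≤ 1)
    (t : ℝ) (ht : 0 ≤ t) (v : V) (y : Y) (h₁ : 0 < w₁ v) (h₂ : 0 < w₂ y v) :
    ∑' k, raceLayer ν k {e | (((t, v), y), e) ∈ raceRegion w₁ w₂} ≤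
      (t.toNNReal * ((w₁ v)⁻¹ + (w₂ y v)⁻¹) : ℝ≥0) := by
  have hm : MeasurableSet {e | (((t, v), y), e) ∈ raceRegion w₁ w₂} :=
    measurable_prodMk_left (measurableSet_raceRegion hw₁ hw₂)
  have hw₂y : Measurable (w₂ y) := hw₂.comp measurable_prodMk_left
  rw [← Measure.sum_apply _ hm, sum_raceLayer, Measure.prod_apply_symm hm]
  calc _ ≤ ∫⁻ v', ((t.toNNReal * (w₁ v)⁻¹ : ℝ≥0) * (w₁ v' : ℝ≥0∞) +
          (t.toNNReal * (w₂ y v)⁻¹ : ℝ≥0) * (w₂ y v' : ℝ≥0∞)) ∂ν := by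
        refine lintegral_mono fun v' => ?_
        exact (measure_union_le {s : ℝ | s * w₁ v ≤ t * w₁ v'} {s | s * w₂ y v ≤ t * w₂ y v'}).trans
          (add_le_add (volume_setOf_mul_le t ht _ _ h₁) (volume_setOf_mul_le t ht _ _ h₂))
    _ = (t.toNNReal * (w₁ v)⁻¹ : ℝ≥0) * ∫⁻ v', (w₁ v' : ℝ≥0∞) ∂ν +
          (t.toNNReal * (w₂ y v)⁻¹ : ℝ≥0) * ∫⁻ v', (w₂ y v' : ℝ≥0∞) ∂ν := by
        rw [lintegral_add_left (by fun_prop), lintegral_const_mul _ (by fun_prop),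
          lintegral_const_mul _ (by fun_prop)]
    _ ≤ (t.toNNReal * (w₁ v)⁻¹ : ℝ≥0) * 1 + (t.toNNReal * (w₂ y v)⁻¹ : ℝ≥0) * 1 := by
        gcongr
        exact hI₂ y
    _ = _ := by rw [mul_one, mul_one, ← ENNReal.coe_add, mul_add]

/-- A form of the Poisson matching lemma. -/
theorem poisson_matching (ν : Measure V) [IsProbabilityMeasure ν]
    (K : Kernel V Y) [IsSFiniteKernel K] {F : V × Y → ℝ≥0∞} (hF : Measurable F)
    {w₁ : V → ℝ≥0} (hw₁ : Measurable w₁) (hI₁ : ∫⁻ v, w₁ v ∂ν ≤ 1)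
    {w₂ : Y → V → ℝ≥0} (hw₂ : Measurable (Function.uncurry w₂))
    (hI₂ : ∀ y, ∫⁻ v, w₂ y v ∂ν ≤ 1) :
    ∫⁻ v, ∫⁻ y, F (v, y) * ((w₁ v : ℝ≥0∞)⁻¹ + (w₂ y v : ℝ≥0∞)⁻¹)⁻¹ ∂K v ∂ν ≤
      ∫⁻ ω, ∑' p : ℕ × ℕ, ∫⁻ y, {y | Wins ω w₁ p ∧ Wins ω (w₂ y) p}.indicator
        (fun y => F (((ω p.1).2 p.2).2, y)) y ∂K ((ω p.1).2 p.2).2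
        ∂poissonPointLaw (raceLayer ν) := by
  -- The exponent `c` uses inverses in `ℝ≥0`, where `0⁻¹ = 0`, so zero weights are excluded. They
  -- contribute nothing to the left side, where the inverse of zero is `∞`.
  set D : Set ((ℝ × V) × Y) := {z | 0 ≤ z.1.1 ∧ 0 < w₁ z.1.2 ∧ 0 < w₂ z.2 z.1.2} with hD
  have hw₂' : Measurable fun z : (ℝ × V) × Y => w₂ z.2 z.1.2 :=
    hw₂.comp (measurable_snd.prodMk measurable_fst.snd)
  have hw₁' : Measurable fun z : (ℝ × V) × Y => w₁ z.1.2 := hw₁.comp measurable_fst.snd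
  have hD₀ : MeasurableSet {z : (ℝ × V) × Y | 0 ≤ z.1.1} :=
    measurableSet_le measurable_const measurable_fst.fst
  have hD₁ : MeasurableSet {z : (ℝ × V) × Y | 0 < w₁ z.1.2} :=
    measurableSet_lt measurable_const hw₁'
  have hD₂ : MeasurableSet {z : (ℝ × V) × Y | 0 < w₂ z.2 z.1.2} :=
    measurableSet_lt measurable_const hw₂'
  have hDm : MeasurableSet D := hD₀.inter (hD₁.inter hD₂)
  set F' : (ℝ × V) × Y → ℝ≥0∞ := D.indicator (fun z => F (z.1.2, z.2)) with hF'
  have hF'm : Measurable F' := (hF.comp (measurable_fst.snd.prodMk measurable_snd)).indicator hDm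
  set c : (ℝ × V) × Y → ℝ≥0 := fun z => z.1.1.toNNReal * ((w₁ z.1.2)⁻¹ + (w₂ z.2 z.1.2)⁻¹) with hc
  have hcm : Measurable c := measurable_fst.fst.real_toNNReal.mul (hw₁'.inv.add hw₂'.inv)
  have key := tsum_lintegral_exp_neg_le_poissonPointLaw (raceLayer ν)
    (K.comap Prod.snd measurable_snd) F' hF'm
    (raceRegion w₁ w₂) (measurableSet_raceRegion hw₁ hw₂) c (by
      rintro ⟨⟨t, v⟩, y⟩ hz
      have hz' : ((t, v), y) ∈ D := Set.mem_of_indicator_ne_zero hz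
      exact tsum_raceLayer_raceRegion_le ν hw₁ hI₁ hw₂ hI₂ t hz'.1 v y hz'.2.1 hz'.2.2)
  have hint : Measurable fun z : (ℝ × V) × Y => F' z * ENNReal.ofReal (Real.exp (-c z)) :=
    hF'm.mul (Real.measurable_exp.comp hcm.coe_nnreal_real.neg).ennreal_ofReal
  refine le_trans (le_of_eq ?_) (key.trans (lintegral_mono fun ω => ENNReal.tsum_le_tsum fun p =>
    lintegral_mono fun y => ?_))
  · rw [← lintegral_sum_measure, sum_raceLayer, lintegral_prod_symm]
    swap
    · exact (hint.lintegral_kernel_prod_right' (κ := K.comap Prod.snd measurable_snd)).aemeasurable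
    refine lintegral_congr fun v => ?_
    simp only [Kernel.comap_apply]
    rw [lintegral_lintegral_swap (f := fun t y =>
      F' ((t, v), y) * ENNReal.ofReal (Real.exp (-c ((t, v), y))))
      (hint.comp (by fun_prop : Measurable fun a : ℝ × Y => ((a.1, v), a.2))).aemeasurable]
    refine lintegral_congr fun y => ?_
    by_cases h1 : w₁ v = 0
    · simp [h1, hF', hD]
    by_cases h2 : w₂ y v = 0
    · simp [h2, hF', hD]
    have h1' : 0 < w₁ v := pos_iff_ne_zero.2 h1
    have h2' : 0 < w₂ y v := pos_iff_ne_zero.2 h2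
    have e : ∫⁻ t in Set.Ici (0 : ℝ), F' ((t, v), y) *
        ENNReal.ofReal (Real.exp (-c ((t, v), y))) = ∫⁻ t in Set.Ici (0 : ℝ), F (v, y) *
        ENNReal.ofReal (Real.exp (-(t.toNNReal * ((w₁ v)⁻¹ + (w₂ y v)⁻¹) : ℝ≥0))) := by
      refine setLIntegral_congr_fun measurableSet_Ici fun t ht => ?_
      have : ((t, v), y) ∈ D := ⟨ht, h1', h2'⟩
      simp only [hF', Set.indicator_of_mem this, hc]
    -- Integrating out the arrival time turns the exponential into the reciprocal of its rate.
    rw [e, lintegral_const_mul _ (by fun_prop), lintegral_exp_neg_mul_Ici _ (by positivity),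
      ENNReal.coe_add, ENNReal.coe_inv h1, ENNReal.coe_inv h2]
  · simp only
    by_cases hA : (ω, ((ω p.1).2 p.2, y)) ∈ avoidEvent (raceRegion w₁ w₂) p
    · rw [Set.indicator_of_mem hA]
      have hmem : y ∈ {y | Wins ω w₁ p ∧ Wins ω (w₂ y) p} := by
        have hq : ∀ q : ℕ × ℕ, q.2 < (ω q.1).1 → q ≠ p → _ ∧ _ := fun q hq hne =>
          not_or.1 (hA.2 q hq hne)
        exact ⟨⟨hA.1, fun q h hne => not_le.1 (hq q h hne).1⟩,
          ⟨hA.1, fun q h hne => not_le.1 (hq q h hne).2⟩⟩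
      rw [Set.indicator_of_mem hmem]
      exact Set.indicator_le_self' (fun _ _ => zero_le) _
    · rw [Set.indicator_of_notMem hA]
      exact zero_le

end Race

/-! ### Information densities and the densities behind them. -/

section InfoDensity

lemma log2E_coe {r : ℝ≥0} (hr : r ≠ 0) : log2E r = (Real.logb 2 r : ℝ) := by
  rw [log2E, ENNReal.log_pos_real' (by simpa [pos_iff_ne_zero] using hr)]
  rw [← EReal.coe_div, Real.logb, ENNReal.coe_toReal]

lemma log2E_zero : log2E 0 = ⊥ := by
  rw [log2E, ENNReal.log_zero]
  exact EReal.bot_div_of_pos_ne_top (by exact_mod_cast Real.log_pos one_lt_two)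
    (EReal.coe_ne_top _)

lemma log2E_top : log2E ∞ = ⊤ := by
  rw [log2E, ENNReal.log_top]
  exact EReal.top_div_of_pos_ne_top (by exact_mod_cast Real.log_pos one_lt_two)
    (EReal.coe_ne_top _)

lemma two_rpow_sub_log2E {r q : ℝ≥0} (hr : r ≠ 0) (hq : q ≠ 0) :
    (2 : ℝ) ^ (-(log2E q).toReal + (log2E r).toReal) = r / q := by
  have hr' : (0 : ℝ) < r := by exact_mod_cast pos_iff_ne_zero.2 hr
  have hq' : (0 : ℝ) < q := by exact_mod_cast pos_iff_ne_zero.2 hq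
  rw [log2E_coe hr, log2E_coe hq, EReal.toReal_coe, EReal.toReal_coe, neg_add_eq_sub,
    Real.rpow_sub two_pos, Real.rpow_logb two_pos (by norm_num) hr',
    Real.rpow_logb two_pos (by norm_num) hq']

/-- This turns the output of `poisson_matching` into the form of the theorem: `L⁻¹` is the reference
probability of the label `m`, `L * r` the encoder's weight and `q` the decoder's. -/
lemma inv_mul_inv_add_inv_inv {L : ℕ} (hL : 0 < L) (r q : ℝ≥0) :
    (L : ℝ≥0∞)⁻¹ * (((L * r : ℝ≥0) : ℝ≥0∞)⁻¹ + (q : ℝ≥0∞)⁻¹)⁻¹ =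
      r * (1 + L * r * (q : ℝ≥0∞)⁻¹)⁻¹ := by
  have hL0 : (L : ℝ≥0∞) ≠ 0 := by exact_mod_cast hL.ne'
  have hLt : (L : ℝ≥0∞) ≠ ∞ := ENNReal.natCast_ne_top L
  by_cases hr : r = 0
  · simp [hr]
  have hr0 : (r : ℝ≥0∞) ≠ 0 := by exact_mod_cast hr
  push_cast
  set a : ℝ≥0∞ := L * r with ha
  have ha0 : a ≠ 0 := mul_ne_zero hL0 hr0
  have hat : a ≠ ∞ := ENNReal.mul_ne_top hLt ENNReal.coe_ne_top
  have h1 : a⁻¹ + (q : ℝ≥0∞)⁻¹ = a⁻¹ * (1 + a * (q : ℝ≥0∞)⁻¹) := by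
    rw [mul_add, mul_one, ← mul_assoc, ENNReal.inv_mul_cancel ha0 hat, one_mul]
  rw [h1, ENNReal.mul_inv (.inl (ENNReal.inv_ne_zero.2 hat)) (.inl (ENNReal.inv_ne_top.2 ha0)),
    inv_inv, ← mul_assoc, ha, ← mul_assoc, ENNReal.inv_mul_cancel hL0 hLt, one_mul]

variable {𝒰 𝒱 : Type*} [MeasurableSpace 𝒰] [MeasurableSpace 𝒱]

lemma IsRNDerivVersion.lintegral_le {κ μ : Measure 𝒰} {r : 𝒰 → ℝ≥0∞}
    (h : IsRNDerivVersion κ μ r) : ∫⁻ u, r u ∂μ ≤ κ Set.univ := by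
  rw [h Set.univ MeasurableSet.univ, setLIntegral_univ]
  exact le_self_add

lemma IsRNDerivVersion.eq_withDensity {κ μ : Measure 𝒰} {r : 𝒰 → ℝ≥0∞}
    (h : IsRNDerivVersion κ μ r) (h0 : κ {u | r u = ∞} = 0) : κ = μ.withDensity r := by
  ext B hB
  rw [h B hB, measure_mono_null Set.inter_subset_right h0, add_zero, withDensity_apply _ hB]

/-- A version of the density behind an information density: its conditional densities have total
mass at most one, and are the densities of any given version of the conditional distribution if
the density is almost surely finite. -/
lemma IsInfoDensity.exists_density [MeasurableSpace.CountableOrCountablyGenerated 𝒱 𝒰]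
    {P : Measure (𝒰 × 𝒱)} [IsProbabilityMeasure P] {ι : 𝒰 → 𝒱 → EReal} (hι : IsInfoDensity P ι) :
    ∃ r : 𝒰 → 𝒱 → ℝ≥0∞, Measurable (Function.uncurry r) ∧
      (∀ v, ∫⁻ u, r u v ∂P.fst ≤ 1) ∧ (∀ u v, ι u v = log2E (r u v)) ∧
      ∀ η : Kernel 𝒱 𝒰, IsMarkovKernel η → P.snd ⊗ₘ η = P.map Prod.swap →
        (∀ᵐ p ∂P, r p.1 p.2 ≠ ∞) → ∀ᵐ v ∂P.snd, η v = P.fst.withDensity fun u => r u v := by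
  obtain ⟨κ, r, hκ, hκP, hr, hrv, hιr⟩ := hι
  refine ⟨r, hr, fun v => (hrv v).lintegral_le.trans prob_le_one, hιr, fun η hη hηP hfin => ?_⟩
  -- Regular conditional distributions are almost surely unique; finiteness of `r` then removes the
  -- singular part of `κ v`.
  have hae : κ =ᵐ[P.snd] η := Kernel.ae_eq_of_compProd_eq (hκP.trans hηP.symm)
  have hm : MeasurableSet {p : 𝒱 × 𝒰 | r p.2 p.1 = ∞} :=
    (hr.comp measurable_swap) (measurableSet_singleton ∞)
  have h1 : ∀ᵐ p ∂(P.snd ⊗ₘ κ), r p.2 p.1 ≠ ∞ := by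
    rw [hκP]
    refine (ae_map_iff measurable_swap.aemeasurable
      (p := fun p : 𝒱 × 𝒰 => r p.2 p.1 ≠ ∞) hm.compl).2 ?_
    exact hfin
  have h2 := (Measure.ae_compProd_iff (by exact hm.compl)).1 h1
  filter_upwards [hae, h2] with v hv h0
  rw [← hv]
  refine (hrv v).eq_withDensity ?_
  rw [ae_iff] at h0
  simpa using h0

end InfoDensity

/-! ### The matching lemma applied to the encoder's and decoder's weights. -/

section Coding

variable {𝒰 𝒴 : Type*} [MeasurableSpace 𝒰] [MeasurableSpace 𝒴] {L : ℕ}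

/-- The encoder's weights: only the points labelled by the message take part in the race. -/
def messageWeight (r : 𝒰 → ℝ≥0) (m : Fin L) (v : 𝒰 × Fin L) : ℝ≥0 :=
  if v.2 = m then L * r v.1 else 0

lemma lintegral_uniformOn_univ_fin (f : Fin L → ℝ≥0∞) :
    ∫⁻ m, f m ∂(uniformOn (Set.univ : Set (Fin L))) = (L : ℝ≥0∞)⁻¹ * ∑ m, f m := by
  rw [lintegral_fintype, Finset.mul_sum]
  refine Finset.sum_congr rfl fun m _ => ?_
  rw [uniformOn_univ, Measure.count_singleton, Fintype.card_fin, mul_comm, one_div]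

lemma isProbabilityMeasure_uniformOn_univ_fin (hL : 0 < L) :
    IsProbabilityMeasure (uniformOn (Set.univ : Set (Fin L))) :=
  isProbabilityMeasure_uniformOn Set.finite_univ ⟨⟨0, hL⟩, trivial⟩

/-- Points carry a value and a label. The factor `L` in `messageWeight` offsets the probability
`1/L` of label `m`, so both weights have mass at most one. The decoder's weight ignores the label,
yet a common winner reveals it. -/
lemma lintegral_winner_ge (hL : 0 < L) (μ : Measure 𝒰) [IsProbabilityMeasure μ]
    [IsProbabilityMeasure (uniformOn (Set.univ : Set (Fin L)))]
    (K : Kernel 𝒰 𝒴) [IsSFiniteKernel K] {r : 𝒰 → ℝ≥0} (hr : Measurable r)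
    (hr1 : ∫⁻ u, r u ∂μ ≤ 1) {q : 𝒴 → 𝒰 → ℝ≥0} (hq : Measurable (Function.uncurry q))
    (hq1 : ∀ y, ∫⁻ u, q y u ∂μ ≤ 1) (m : Fin L) (v₀ : 𝒰 × Fin L) {G : Set (𝒰 × 𝒴)}
    (hG : MeasurableSet G) :
    ∫⁻ u, r u * ∫⁻ y, G.indicator 1 (u, y) * (1 + L * r u * (q y u : ℝ≥0∞)⁻¹)⁻¹ ∂K u ∂μ ≤
      ∫⁻ ω, K (winner v₀ ω (messageWeight r m)).1
        {y | (winner v₀ ω (messageWeight r m)).2 = m ∧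
          winner v₀ ω (fun v => q y v.1) = winner v₀ ω (messageWeight r m) ∧
          ((winner v₀ ω (messageWeight r m)).1, y) ∈ G}
        ∂poissonPointLaw (raceLayer (μ.prod (uniformOn (Set.univ : Set (Fin L))))) := by
  have hmf (a : ℝ≥0∞) : (∑ m' : Fin L, if m' = m then a else 0) = a := by simp
  have hw₁ : Measurable (messageWeight r m) := by
    unfold messageWeight
    exact Measurable.ite (measurable_snd (measurableSet_singleton m))
      ((hr.comp measurable_fst).const_mul _) measurable_const
  have hI₁ : ∫⁻ v, messageWeight r m v ∂(μ.prod (uniformOn (Set.univ : Set (Fin L)))) ≤ 1 := by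
    rw [lintegral_prod _ (by fun_prop)]
    refine le_trans (le_of_eq (lintegral_congr fun u => ?_)) hr1
    rw [lintegral_uniformOn_univ_fin]
    simp only [messageWeight, apply_ite ((↑) : ℝ≥0 → ℝ≥0∞), ENNReal.coe_zero]
    rw [hmf, ENNReal.coe_mul, ENNReal.coe_natCast, ← mul_assoc,
      ENNReal.inv_mul_cancel (by exact_mod_cast hL.ne') (ENNReal.natCast_ne_top L), one_mul]
  have hw₂ : Measurable (Function.uncurry fun (y : 𝒴) (v : 𝒰 × Fin L) => q y v.1) :=
    hq.comp (measurable_fst.prodMk measurable_snd.fst)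
  have hI₂ (y : 𝒴) :
      ∫⁻ v, q y v.1 ∂(μ.prod (uniformOn (Set.univ : Set (Fin L)))) ≤ 1 := by
    rw [lintegral_prod _ (by have := hw₂.comp (measurable_prodMk_left (x := y)); fun_prop)]
    simpa using hq1 y
  set F : (𝒰 × Fin L) × 𝒴 → ℝ≥0∞ :=
    {z | z.1.2 = m ∧ (z.1.1, z.2) ∈ G}.indicator 1 with hF
  have hFs : MeasurableSet {z : (𝒰 × Fin L) × 𝒴 | z.1.2 = m ∧ (z.1.1, z.2) ∈ G} :=
    (measurable_fst.snd (measurableSet_singleton m)).inter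
      ((measurable_fst.fst.prodMk measurable_snd) hG)
  have hFm : Measurable F := measurable_one.indicator hFs
  have key := poisson_matching (μ.prod (uniformOn (Set.univ : Set (Fin L))))
    (K.comap Prod.fst measurable_fst) hFm hw₁ hI₁ hw₂ hI₂
  refine le_trans (le_of_eq ?_) (key.trans (lintegral_mono fun ω => ?_))
  · have hint : Measurable fun z : (𝒰 × Fin L) × 𝒴 => F z *
        ((messageWeight r m z.1 : ℝ≥0∞)⁻¹ + (q z.2 z.1.1 : ℝ≥0∞)⁻¹)⁻¹ := by
      have h2 : Measurable fun z : (𝒰 × Fin L) × 𝒴 => q z.2 z.1.1 :=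
        hq.comp (measurable_snd.prodMk measurable_fst.fst)
      fun_prop
    rw [lintegral_prod _
      (hint.lintegral_kernel_prod_right' (κ := K.comap Prod.fst measurable_fst)).aemeasurable]
    refine lintegral_congr fun u => ?_
    rw [lintegral_uniformOn_univ_fin, Finset.sum_eq_single m]
    · simp only [Kernel.comap_apply]
      rw [← lintegral_const_mul' _ _ (ENNReal.inv_ne_top.2 (by exact_mod_cast hL.ne')),
        ← lintegral_const_mul' _ _ ENNReal.coe_ne_top]
      refine lintegral_congr fun y => ?_
      have e : F ((u, m), y) = G.indicator 1 (u, y) := by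
        by_cases h : (u, y) ∈ G <;> simp [hF, h]
      simp only [e, messageWeight, if_true]
      rw [mul_left_comm, mul_left_comm (L : ℝ≥0∞)⁻¹, inv_mul_inv_add_inv_inv hL]
    · intro m' _ hm'
      simp [hF, hm']
    · simp
  · set X := K (winner v₀ ω (messageWeight r m)).1
        {y | (winner v₀ ω (messageWeight r m)).2 = m ∧
          winner v₀ ω (fun v => q y v.1) = winner v₀ ω (messageWeight r m) ∧
          ((winner v₀ ω (messageWeight r m)).1, y) ∈ G} with hX
    by_cases h : ∃ p, Wins ω (messageWeight r m) p
    · obtain ⟨p, hp⟩ := h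
      -- A race has at most one winner, so the sum over points has a single term.
      rw [tsum_eq_single p]
      · rw [Kernel.comap_apply, ← hp.winner_eq (v₀ := v₀), hX]
        set v := winner v₀ ω (messageWeight r m) with hv
        refine le_trans (lintegral_mono fun y => ?_) (lintegral_indicator_one_le _)
        by_cases hy : y ∈ {y | Wins ω (messageWeight r m) p ∧ Wins ω (fun v => q y v.1) p}
        · rw [Set.indicator_of_mem hy]
          have e : winner v₀ ω (fun v => q y v.1) = v := by
            rw [hy.2.winner_eq, hv, hp.winner_eq]
          by_cases h : v.2 = m ∧ (v.1, y) ∈ G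
          · rw [Set.indicator_of_mem (show y ∈ {y | v.2 = m ∧
              winner v₀ ω (fun v => q y v.1) = v ∧ (v.1, y) ∈ G} from ⟨h.1, e, h.2⟩)]
            exact Set.indicator_le_self' (fun _ _ => zero_le) _
          · rw [hF, Set.indicator_of_notMem (by exact h)]
            exact zero_le
        · rw [Set.indicator_of_notMem hy]
          exact zero_le
      · intro p' hp'
        have : {y | Wins ω (messageWeight r m) p' ∧ Wins ω (fun v => q y v.1) p'} = ∅ := by
          ext y
          simp only [Set.mem_ofPred_eq, Set.mem_empty_iff_false, iff_false]
          exact fun h => hp' (h.1.unique hp)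
        simp [this]
    · refine le_of_eq_of_le (ENNReal.tsum_eq_zero.2 fun p => ?_) zero_le
      have : {y | Wins ω (messageWeight r m) p ∧ Wins ω (fun v => q y v.1) p} = ∅ := by
        ext y
        simp only [Set.mem_ofPred_eq, Set.mem_empty_iff_false, iff_false]
        exact fun h' => h ⟨p, h'.1⟩
      simp [this]

end Coding

/-! ### The coding scheme for a fixed codebook, its measurability, and stability in total variation.
-/

section Scheme

variable {𝒮e 𝒮d 𝒰 𝒳 𝒴 : Type*} [MeasurableSpace 𝒮e] [MeasurableSpace 𝒮d]
    [MeasurableSpace 𝒰] [MeasurableSpace 𝒳] [MeasurableSpace 𝒴] {L : ℕ}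

lemma measurable_messageWeight {r : 𝒮e → 𝒰 → ℝ≥0} (hr : Measurable (Function.uncurry r)) :
    Measurable (Function.uncurry fun p : 𝒮e × Fin L => messageWeight (r p.1) p.2) := by
  have h : MeasurableSet {a : (𝒮e × Fin L) × (𝒰 × Fin L) | a.2.2 = a.1.2} :=
    measurableSet_eq_fun measurable_snd.snd measurable_fst.snd
  exact Measurable.ite h ((hr.comp (measurable_fst.fst.prodMk measurable_snd.fst)).const_mul _)
    measurable_const

lemma measurable_winner_messageWeight (v₀ : 𝒰 × Fin L) {r : 𝒮e → 𝒰 → ℝ≥0}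
    (hr : Measurable (Function.uncurry r)) :
    Measurable fun a : (ℕ → ℕ × (ℕ → ℝ × (𝒰 × Fin L))) × (𝒮e × Fin L) =>
      winner v₀ a.1 (messageWeight (r a.2.1) a.2.2) :=
  measurable_winner v₀ (measurable_messageWeight hr)

lemma measurable_winner_snd (v₀ : 𝒰 × Fin L) {q : 𝒴 × 𝒮d → 𝒰 → ℝ≥0}
    (hq : Measurable (Function.uncurry q)) :
    Measurable fun a : (ℕ → ℕ × (ℕ → ℝ × (𝒰 × Fin L))) × (𝒮d × 𝒴) =>
      winner v₀ a.1 (fun v => q (a.2.2, a.2.1) v.1) :=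
  measurable_winner v₀ (w := fun (p : 𝒮d × 𝒴) (v : 𝒰 × Fin L) => q (p.2, p.1) v.1)
    (hq.comp ((measurable_fst.snd.prodMk measurable_fst.fst).prodMk measurable_snd.fst))

/-- The scheme with shared codebook `θ.1` and encoder randomness `θ.2`: the encoder and the decoder
run races on the same codebook, with their own weights. -/
def raceScheme (v₀ : 𝒰 × Fin L) {r : 𝒮e → 𝒰 → ℝ≥0} (hr : Measurable (Function.uncurry r))
    {q : 𝒴 × 𝒮d → 𝒰 → ℝ≥0} (hq : Measurable (Function.uncurry q))
    {g : 𝒮e × 𝒰 → unitInterval → 𝒳} (hg : Measurable (Function.uncurry g))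
    {xhat : 𝒰 × Fin L × 𝒮d × 𝒴 → 𝒳} (hxhat : Measurable xhat)
    (θ : (ℕ → ℕ × (ℕ → ℝ × (𝒰 × Fin L))) × unitInterval) : HidingScheme 𝒮e 𝒮d 𝒳 𝒴 L where
  enc p := g (p.1, (winner v₀ θ.1 (messageWeight (r p.1) p.2)).1) θ.2
  dec p := ((winner v₀ θ.1 fun v => q (p.2, p.1) v.1).2,
    xhat ((winner v₀ θ.1 fun v => q (p.2, p.1) v.1).1,
      (winner v₀ θ.1 fun v => q (p.2, p.1) v.1).2, p.1, p.2))
  measurable_enc := by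
    have h := (measurable_winner_messageWeight v₀ hr).comp (measurable_prodMk_left (x := θ.1))
    exact hg.comp ((measurable_fst.prodMk h.fst).prodMk measurable_const)
  measurable_dec := by
    have h := (measurable_winner_snd v₀ hq).comp (measurable_prodMk_left (x := θ.1))
    exact h.snd.prodMk (hxhat.comp (h.fst.prodMk (h.snd.prodMk measurable_id)))

lemma measurable_raceScheme_enc (v₀ : 𝒰 × Fin L) {r : 𝒮e → 𝒰 → ℝ≥0}
    (hr : Measurable (Function.uncurry r)) {q : 𝒴 × 𝒮d → 𝒰 → ℝ≥0}
    (hq : Measurable (Function.uncurry q)) {g : 𝒮e × 𝒰 → unitInterval → 𝒳}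
    (hg : Measurable (Function.uncurry g)) {xhat : 𝒰 × Fin L × 𝒮d × 𝒴 → 𝒳}
    (hxhat : Measurable xhat) :
    Measurable fun a : ((ℕ → ℕ × (ℕ → ℝ × (𝒰 × Fin L))) × unitInterval) × (𝒮e × Fin L) =>
      (raceScheme v₀ hr hq hg hxhat a.1).enc a.2 := by
  have h := (measurable_winner_messageWeight v₀ hr).comp
    ((measurable_fst.fst.prodMk measurable_snd) : Measurable fun
      a : ((ℕ → ℕ × (ℕ → ℝ × (𝒰 × Fin L))) × unitInterval) × (𝒮e × Fin L) => (a.1.1, a.2))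
  exact hg.comp ((measurable_snd.fst.prodMk h.fst).prodMk measurable_fst.snd)

lemma measurable_raceScheme_dec (v₀ : 𝒰 × Fin L) {r : 𝒮e → 𝒰 → ℝ≥0}
    (hr : Measurable (Function.uncurry r)) {q : 𝒴 × 𝒮d → 𝒰 → ℝ≥0}
    (hq : Measurable (Function.uncurry q)) {g : 𝒮e × 𝒰 → unitInterval → 𝒳}
    (hg : Measurable (Function.uncurry g)) {xhat : 𝒰 × Fin L × 𝒮d × 𝒴 → 𝒳}
    (hxhat : Measurable xhat) :
    Measurable fun a : ((ℕ → ℕ × (ℕ → ℝ × (𝒰 × Fin L))) × unitInterval) × (𝒮d × 𝒴) =>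
      (raceScheme v₀ hr hq hg hxhat a.1).dec a.2 := by
  have h := (measurable_winner_snd v₀ hq).comp
    ((measurable_fst.fst.prodMk measurable_snd) : Measurable fun
      a : ((ℕ → ℕ × (ℕ → ℝ × (𝒰 × Fin L))) × unitInterval) × (𝒮d × 𝒴) => (a.1.1, a.2))
  exact h.snd.prodMk (hxhat.comp (h.fst.prodMk (h.snd.prodMk measurable_snd)))

/-- Measurability jointly with the codebook `θ` is what allows averaging over codebooks. -/
lemma measurableSet_failure_of_measurable {Θ : Type*} [MeasurableSpace Θ]
    (c : Θ → HidingScheme 𝒮e 𝒮d 𝒳 𝒴 L)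
    (henc : Measurable fun a : Θ × (𝒮e × Fin L) => (c a.1).enc a.2)
    (hdec : Measurable fun a : Θ × (𝒮d × 𝒴) => (c a.1).dec a.2)
    {d₁ : 𝒮e → 𝒳 → ℝ≥0} (hd₁ : Measurable (Function.uncurry d₁))
    {d₂ : 𝒳 → 𝒳 → ℝ≥0} (hd₂ : Measurable (Function.uncurry d₂)) (D₁ D₂ : ℝ) :
    MeasurableSet {b : (Θ × ((𝒮e × 𝒮d) × Fin L)) × 𝒴 |
      (b.1.2, b.2) ∈ (c b.1.1).failure d₁ d₂ D₁ D₂} := by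
  have hx : Measurable fun b : (Θ × ((𝒮e × 𝒮d) × Fin L)) × 𝒴 =>
      (c b.1.1).enc (b.1.2.1.1, b.1.2.2) :=
    henc.comp (measurable_fst.fst.prodMk (measurable_fst.snd.fst.fst.prodMk measurable_fst.snd.snd))
  have hy : Measurable fun b : (Θ × ((𝒮e × 𝒮d) × Fin L)) × 𝒴 =>
      (c b.1.1).dec (b.1.2.1.2, b.2) :=
    hdec.comp (measurable_fst.fst.prodMk (measurable_fst.snd.fst.snd.prodMk measurable_snd))
  have h1 : MeasurableSet {b : (Θ × ((𝒮e × 𝒮d) × Fin L)) × 𝒴 |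
      D₁ < d₁ b.1.2.1.1 ((c b.1.1).enc (b.1.2.1.1, b.1.2.2))} :=
    measurableSet_lt measurable_const
      (hd₁.comp (measurable_fst.snd.fst.fst.prodMk hx)).coe_nnreal_real
  have h2 : MeasurableSet {b : (Θ × ((𝒮e × 𝒮d) × Fin L)) × 𝒴 |
      D₂ < d₂ ((c b.1.1).enc (b.1.2.1.1, b.1.2.2)) ((c b.1.1).dec (b.1.2.1.2, b.2)).2} :=
    measurableSet_lt measurable_const (hd₂.comp (hx.prodMk hy.snd)).coe_nnreal_real
  have h3 : MeasurableSet {b : (Θ × ((𝒮e × 𝒮d) × Fin L)) × 𝒴 |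
      b.1.2.2 = ((c b.1.1).dec (b.1.2.1.2, b.2)).1} :=
    measurableSet_eq_fun measurable_fst.snd.snd hy.fst
  exact h1.union (h2.union h3.compl)

lemma HidingScheme.measurableSet_failure (c : HidingScheme 𝒮e 𝒮d 𝒳 𝒴 L)
    {d₁ : 𝒮e → 𝒳 → ℝ≥0} (hd₁ : Measurable (Function.uncurry d₁))
    {d₂ : 𝒳 → 𝒳 → ℝ≥0} (hd₂ : Measurable (Function.uncurry d₂)) (D₁ D₂ : ℝ) :
    MeasurableSet (c.failure d₁ d₂ D₁ D₂) := by
  have h := measurableSet_failure_of_measurable (fun _ : Unit => c)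
    (c.measurable_enc.comp measurable_snd) (c.measurable_dec.comp measurable_snd) hd₁ hd₂ D₁ D₂
  exact ((measurable_const.prodMk measurable_fst).prodMk measurable_snd :
    Measurable fun b : ((𝒮e × 𝒮d) × Fin L) × 𝒴 => (((), b.1), b.2)) h

lemma HidingScheme.law_apply (c : HidingScheme 𝒮e 𝒮d 𝒳 𝒴 L) (P : Measure (𝒮e × 𝒮d))
    [SFinite P] (A : Kernel 𝒳 𝒴) [IsSFiniteKernel A]
    {S : Set (((𝒮e × 𝒮d) × Fin L) × 𝒴)} (hS : MeasurableSet S) :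
    c.law P A S = ∫⁻ p, A (c.enc (p.1.1, p.2)) (Prod.mk p ⁻¹' S)
      ∂(P.prod (uniformOn (Set.univ : Set (Fin L)))) := by
  rw [HidingScheme.law, Measure.compProd_apply hS]
  rfl

/-- The attack enters only as the conditional law of `Y` given `X`; the bound holds for each input
and is then averaged. -/
lemma HidingScheme.law_le_add_of_channelDist_le (c : HidingScheme 𝒮e 𝒮d 𝒳 𝒴 L)
    (hL : 0 < L) (P : Measure (𝒮e × 𝒮d)) [IsProbabilityMeasure P] (A B : Kernel 𝒳 𝒴)
    [IsMarkovKernel A] [IsMarkovKernel B] {ε : ℝ≥0} (hAB : channelDist A B ≤ ε)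
    {S : Set (((𝒮e × 𝒮d) × Fin L) × 𝒴)} (hS : MeasurableSet S) :
    c.law P A S ≤ c.law P B S + ε := by
  have := isProbabilityMeasure_uniformOn_univ_fin hL
  rw [c.law_apply P A hS, c.law_apply P B hS]
  have h (x : 𝒳) (T : Set 𝒴) (hT : MeasurableSet T) : A x T ≤ B x T + ε := by
    have h1 : ENNReal.ofReal |(A x).real T - (B x).real T| ≤ ε :=
      le_trans (le_trans (le_iSup₂_of_le T hT le_rfl) (le_iSup (fun x => tvDist (A x) (B x)) x)) hAB
    have h2 : (A x).real T ≤ (B x).real T + ε := by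
      have h3 : |(A x).real T - (B x).real T| ≤ ε := by
        have := ENNReal.toReal_mono ENNReal.coe_ne_top h1
        rwa [ENNReal.toReal_ofReal (abs_nonneg _)] at this
      linarith [le_abs_self ((A x).real T - (B x).real T)]
    rw [← ofReal_measureReal (μ := A x), ← ofReal_measureReal (μ := B x),
      ← ENNReal.ofReal_coe_nnreal, ← ENNReal.ofReal_add measureReal_nonneg (NNReal.coe_nonneg ε)]
    exact ENNReal.ofReal_le_ofReal h2
  calc _ ≤ ∫⁻ p, (B (c.enc (p.1.1, p.2)) (Prod.mk p ⁻¹' S) + ε)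
        ∂(P.prod (uniformOn (Set.univ : Set (Fin L)))) :=
        lintegral_mono fun p => h _ _ (measurable_prodMk_left hS)
    _ = _ := by rw [lintegral_add_right _ measurable_const]; simp

lemma measurable_law_failure {Θ : Type*} [MeasurableSpace Θ]
    (c : Θ → HidingScheme 𝒮e 𝒮d 𝒳 𝒴 L)
    (henc : Measurable fun a : Θ × (𝒮e × Fin L) => (c a.1).enc a.2)
    (hdec : Measurable fun a : Θ × (𝒮d × 𝒴) => (c a.1).dec a.2)
    {d₁ : 𝒮e → 𝒳 → ℝ≥0} (hd₁ : Measurable (Function.uncurry d₁))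
    {d₂ : 𝒳 → 𝒳 → ℝ≥0} (hd₂ : Measurable (Function.uncurry d₂)) (D₁ D₂ : ℝ)
    (P : Measure (𝒮e × 𝒮d)) [SFinite P] (A : Kernel 𝒳 𝒴) [IsSFiniteKernel A] :
    (Measurable fun a : Θ × ((𝒮e × 𝒮d) × Fin L) =>
      A ((c a.1).enc (a.2.1.1, a.2.2)) (Prod.mk a.2 ⁻¹' (c a.1).failure d₁ d₂ D₁ D₂)) ∧
    Measurable fun θ => (c θ).law P A ((c θ).failure d₁ d₂ D₁ D₂) := by
  have hx : Measurable fun a : Θ × ((𝒮e × 𝒮d) × Fin L) => (c a.1).enc (a.2.1.1, a.2.2) :=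
    henc.comp (measurable_fst.prodMk (measurable_snd.fst.fst.prodMk measurable_snd.snd))
  have h1 := Kernel.measurable_kernel_prodMk_left (κ := A.comap _ hx)
    (measurableSet_failure_of_measurable c henc hdec hd₁ hd₂ D₁ D₂)
  refine ⟨h1, ?_⟩
  simp_rw [fun θ => (c θ).law_apply P A ((c θ).measurableSet_failure hd₁ hd₂ D₁ D₂)]
  exact Measurable.lintegral_prod_right' h1

end Scheme

/-! ### Success probability of the random scheme for given side information and message. -/

section RandomCoding

variable {𝒮e 𝒮d 𝒰 𝒳 𝒴 : Type*} [MeasurableSpace 𝒮e] [MeasurableSpace 𝒮d]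
    [MeasurableSpace 𝒰] [MeasurableSpace 𝒳] [MeasurableSpace 𝒴] {L : ℕ}

/-- The reconstructions `X` and `X̂` both meet their distortion constraints. -/
def goodSet (d₁ : 𝒮e → 𝒳 → ℝ≥0) (d₂ : 𝒳 → 𝒳 → ℝ≥0) (D₁ D₂ : ℝ)
    (xhat : 𝒰 × Fin L × 𝒮d × 𝒴 → 𝒳) :
    Set (Fin L × (((𝒮e × 𝒮d) × (𝒰 × 𝒳)) × 𝒴)) :=
  {a | d₁ a.2.1.1.1 a.2.1.2.2 ≤ D₁ ∧
    d₂ a.2.1.2.2 (xhat (a.2.1.2.1, a.1, a.2.1.1.2, a.2.2)) ≤ D₂}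

lemma measurableSet_goodSet {d₁ : 𝒮e → 𝒳 → ℝ≥0} (hd₁ : Measurable (Function.uncurry d₁))
    {d₂ : 𝒳 → 𝒳 → ℝ≥0} (hd₂ : Measurable (Function.uncurry d₂)) (D₁ D₂ : ℝ)
    {xhat : 𝒰 × Fin L × 𝒮d × 𝒴 → 𝒳} (hxhat : Measurable xhat) :
    MeasurableSet (goodSet (L := L) d₁ d₂ D₁ D₂ xhat) := by
  have h1 : Measurable fun a : Fin L × (((𝒮e × 𝒮d) × (𝒰 × 𝒳)) × 𝒴) =>
      (d₁ a.2.1.1.1 a.2.1.2.2 : ℝ) :=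
    (hd₁.comp (by fun_prop : Measurable fun a : Fin L × (((𝒮e × 𝒮d) × (𝒰 × 𝒳)) × 𝒴) =>
      (a.2.1.1.1, a.2.1.2.2))).coe_nnreal_real
  have h2 : Measurable fun a : Fin L × (((𝒮e × 𝒮d) × (𝒰 × 𝒳)) × 𝒴) =>
      (d₂ a.2.1.2.2 (xhat (a.2.1.2.1, a.1, a.2.1.1.2, a.2.2)) : ℝ) :=
    (hd₂.comp (by fun_prop : Measurable fun a : Fin L × (((𝒮e × 𝒮d) × (𝒰 × 𝒳)) × 𝒴) =>
      (a.2.1.2.2, xhat (a.2.1.2.1, a.1, a.2.1.1.2, a.2.2)))).coe_nnreal_real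
  exact (measurableSet_le h1 measurable_const).inter (measurableSet_le h2 measurable_const)

/-- The guaranteed conditional probability of success, for weights `r` and `q`. -/
def gain (L : ℕ) (r : 𝒮e → 𝒰 → ℝ≥0) (q : 𝒴 × 𝒮d → 𝒰 → ℝ≥0)
    (ω : ((𝒮e × 𝒮d) × (𝒰 × 𝒳)) × 𝒴) : ℝ≥0∞ :=
  (1 + L * r ω.1.1.1 ω.1.2.1 * (q (ω.2, ω.1.1.2) ω.1.2.1 : ℝ≥0∞)⁻¹)⁻¹

lemma measurable_gain (L : ℕ) {r : 𝒮e → 𝒰 → ℝ≥0} (hr : Measurable (Function.uncurry r))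
    {q : 𝒴 × 𝒮d → 𝒰 → ℝ≥0} (hq : Measurable (Function.uncurry q)) :
    Measurable (gain (𝒳 := 𝒳) L r q) := by
  have h1 : Measurable fun ω : ((𝒮e × 𝒮d) × (𝒰 × 𝒳)) × 𝒴 => r ω.1.1.1 ω.1.2.1 :=
    hr.comp (by fun_prop : Measurable fun ω : ((𝒮e × 𝒮d) × (𝒰 × 𝒳)) × 𝒴 => (ω.1.1.1, ω.1.2.1))
  have h2 : Measurable fun ω : ((𝒮e × 𝒮d) × (𝒰 × 𝒳)) × 𝒴 => q (ω.2, ω.1.1.2) ω.1.2.1 :=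
    hq.comp (by fun_prop : Measurable fun ω : ((𝒮e × 𝒮d) × (𝒰 × 𝒳)) × 𝒴 =>
      ((ω.2, ω.1.1.2), ω.1.2.1))
  unfold gain
  fun_prop

/-- The law of the shared codebook and the encoder randomness. -/
def codebookLaw (L : ℕ) (μ : Measure 𝒰) [IsProbabilityMeasure μ]
    [IsProbabilityMeasure (uniformOn (Set.univ : Set (Fin L)))] :
    Measure ((ℕ → ℕ × (ℕ → ℝ × (𝒰 × Fin L))) × unitInterval) :=
  (poissonPointLaw (raceLayer (μ.prod (uniformOn (Set.univ : Set (Fin L)))))).prod volume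

instance (μ : Measure 𝒰) [IsProbabilityMeasure μ]
    [IsProbabilityMeasure (uniformOn (Set.univ : Set (Fin L)))] :
    IsProbabilityMeasure (codebookLaw L μ) := by
  unfold codebookLaw; infer_instance

/-- Once the uniform variable `w` is fixed, `X` is a function of `(S^e, U)`, so the attack becomes
the channel from `U` to `Y` given by `A` after `g`, and `lintegral_winner_ge` applies. Averaging
over `w` restores the conditional law `κ` of `X`. -/
lemma lintegral_success_ge
    (v₀ : 𝒰 × Fin L) {r : 𝒮e → 𝒰 → ℝ≥0} (hr : Measurable (Function.uncurry r))
    {q : 𝒴 × 𝒮d → 𝒰 → ℝ≥0} (hq : Measurable (Function.uncurry q))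
    {g : 𝒮e × 𝒰 → unitInterval → 𝒳} (hg : Measurable (Function.uncurry g))
    {xhat : 𝒰 × Fin L × 𝒮d × 𝒴 → 𝒳} (hxhat : Measurable xhat)
    {d₁ : 𝒮e → 𝒳 → ℝ≥0} (hd₁ : Measurable (Function.uncurry d₁))
    {d₂ : 𝒳 → 𝒳 → ℝ≥0} (hd₂ : Measurable (Function.uncurry d₂)) (D₁ D₂ : ℝ)
    (hL : 0 < L) (μ : Measure 𝒰) [IsProbabilityMeasure μ]
    [IsProbabilityMeasure (uniformOn (Set.univ : Set (Fin L)))]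
    (hr1 : ∀ s, ∫⁻ u, r s u ∂μ ≤ 1) (hq1 : ∀ y, ∫⁻ u, q y u ∂μ ≤ 1)
    (A : Kernel 𝒳 𝒴) [IsMarkovKernel A]
    (PUX : Kernel 𝒮e (𝒰 × 𝒳)) [IsMarkovKernel PUX]
    (κ : Kernel (𝒮e × 𝒰) 𝒳) [IsMarkovKernel κ] (hκ : PUX.fst ⊗ₖ κ = PUX)
    (hgκ : ∀ a, volume.map (g a) = κ a) (se : 𝒮e) (sd : 𝒮d) (m : Fin L)
    (hdens : PUX.fst se = μ.withDensity fun u => r se u) :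
    ∫⁻ ux, ∫⁻ y, (goodSet d₁ d₂ D₁ D₂ xhat).indicator 1 (m, ((se, sd), ux), y) *
        gain L r q (((se, sd), ux), y) ∂A ux.2 ∂PUX se ≤
      ∫⁻ θ, A ((raceScheme v₀ hr hq hg hxhat θ).enc (se, m))
        (Prod.mk ((se, sd), m) ⁻¹' ((raceScheme v₀ hr hq hg hxhat θ).failure d₁ d₂ D₁ D₂)ᶜ)
        ∂codebookLaw L μ := by
  set Φ : 𝒰 × 𝒳 → ℝ≥0∞ := fun ux =>
    ∫⁻ y, (goodSet d₁ d₂ D₁ D₂ xhat).indicator 1 (m, ((se, sd), ux), y) *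
        gain L r q (((se, sd), ux), y) ∂A ux.2 with hΦ
  have hgood := measurableSet_goodSet (L := L) hd₁ hd₂ D₁ D₂ hxhat
  have hin : Measurable fun b : (𝒰 × 𝒳) × 𝒴 =>
      (goodSet d₁ d₂ D₁ D₂ xhat).indicator (fun _ => (1 : ℝ≥0∞)) (m, ((se, sd), b.1), b.2) *
        gain L r q (((se, sd), b.1), b.2) :=
    ((measurable_const.indicator hgood).comp (measurable_const.prodMk
      ((measurable_const.prodMk measurable_fst).prodMk measurable_snd))).mul
      ((measurable_gain L hr hq).comp ((measurable_const.prodMk measurable_fst).prodMk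
        measurable_snd))
  have hΦm : Measurable Φ :=
    hin.lintegral_kernel_prod_right' (κ := A.comap Prod.snd measurable_snd)
  have hrs : Measurable (r se) := hr.comp measurable_prodMk_left
  have hgs : Measurable fun a : 𝒰 × unitInterval => g (se, a.1) a.2 :=
    hg.comp (by fun_prop : Measurable fun a : 𝒰 × unitInterval => ((se, a.1), a.2))
  have hqs : Measurable (Function.uncurry fun (y : 𝒴) (u : 𝒰) => q (y, sd) u) :=
    hq.comp (by fun_prop : Measurable fun a : 𝒴 × 𝒰 => ((a.1, sd), a.2))
  -- Only the first conjunct is used; it does not involve the source law, so the zero measure serves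
  -- as a dummy.
  have hsm := (measurable_law_failure (raceScheme v₀ hr hq hg hxhat)
    (measurable_raceScheme_enc v₀ hr hq hg hxhat) (measurable_raceScheme_dec v₀ hr hq hg hxhat)
    hd₁ hd₂ D₁ D₂ (0 : Measure (𝒮e × 𝒮d)) A).1
  have hcompl (θ) : A ((raceScheme v₀ hr hq hg hxhat θ).enc (se, m))
        (Prod.mk ((se, sd), m) ⁻¹' ((raceScheme v₀ hr hq hg hxhat θ).failure d₁ d₂ D₁ D₂)ᶜ) =
      1 - A ((raceScheme v₀ hr hq hg hxhat θ).enc (se, m))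
        (Prod.mk ((se, sd), m) ⁻¹' ((raceScheme v₀ hr hq hg hxhat θ).failure d₁ d₂ D₁ D₂)) := by
    rw [Set.preimage_compl, prob_compl_eq_one_sub (measurable_prodMk_left
      ((raceScheme v₀ hr hq hg hxhat θ).measurableSet_failure hd₁ hd₂ D₁ D₂))]
  have hmeas : Measurable fun θ => A ((raceScheme v₀ hr hq hg hxhat θ).enc (se, m))
        (Prod.mk ((se, sd), m) ⁻¹' ((raceScheme v₀ hr hq hg hxhat θ).failure d₁ d₂ D₁ D₂)ᶜ) := by
    simp_rw [hcompl]
    exact measurable_const.sub (hsm.comp (measurable_prodMk_right (y := ((se, sd), m))))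
  rw [codebookLaw, lintegral_prod_symm _ hmeas.aemeasurable]
  calc ∫⁻ ux, Φ ux ∂PUX se
      = ∫⁻ u, ∫⁻ x, Φ (u, x) ∂κ (se, u) ∂(PUX.fst se) := by
        conv_lhs => rw [← hκ]
        rw [Kernel.lintegral_compProd _ _ _ hΦm]
    _ = ∫⁻ u, r se u * ∫⁻ w, Φ (u, g (se, u) w) ∂volume ∂μ := by
        have hmap (u : 𝒰) : ∫⁻ x, Φ (u, x) ∂κ (se, u) =
            ∫⁻ w, Φ (u, g (se, u) w) ∂volume := by
          have hgu : Measurable (g (se, u)) := hgs.comp (measurable_prodMk_left (x := u))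
          rw [← hgκ, lintegral_map (f := fun x => Φ (u, x)) (hΦm.comp measurable_prodMk_left) hgu]
        simp_rw [hmap]
        rw [hdens, lintegral_withDensity_eq_lintegral_mul _ (by fun_prop)]
        · rfl
        · exact Measurable.lintegral_prod_right' (f := fun a : 𝒰 × unitInterval =>
            Φ (a.1, g (se, a.1) a.2)) (hΦm.comp (measurable_fst.prodMk hgs))
    _ = ∫⁻ w, ∫⁻ u, r se u * Φ (u, g (se, u) w) ∂μ ∂volume := by
        rw [lintegral_lintegral_swap (f := fun (w : unitInterval) (u : 𝒰) =>
          r se u * Φ (u, g (se, u) w))]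
        · refine lintegral_congr fun u => ?_
          rw [lintegral_const_mul' _ _ ENNReal.coe_ne_top]
        · exact ((hrs.comp measurable_snd).coe_nnreal_ennreal.mul
            (hΦm.comp (measurable_snd.prodMk (hgs.comp measurable_swap)))).aemeasurable
    _ ≤ _ := by
        refine lintegral_mono fun w => ?_
        have hgw : Measurable fun u => g (se, u) w := hgs.comp measurable_prodMk_right
        set G : Set (𝒰 × 𝒴) :=
          {a | (m, ((se, sd), (a.1, g (se, a.1) w)), a.2) ∈ goodSet d₁ d₂ D₁ D₂ xhat} with hG
        have hGm : MeasurableSet G :=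
          (by fun_prop : Measurable fun a : 𝒰 × 𝒴 =>
            (m, ((se, sd), (a.1, g (se, a.1) w)), a.2)) hgood
        refine le_trans (le_of_eq ?_) ((lintegral_winner_ge hL μ (A.comap _ hgw) hrs (hr1 se) hqs
          (fun y => hq1 _) m v₀ hGm).trans (lintegral_mono fun ω => measure_mono ?_))
        · rfl
        -- With a common winner labelled `m`, the decoder outputs `m` and computes its
        -- reconstruction from the encoder's own `u`.
        · rintro y ⟨h1, h2, h3⟩
          simp only [Set.mem_preimage, Set.mem_compl_iff, HidingScheme.failure, Set.mem_ofPred_eq,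
            raceScheme, h2, h1]
          simp only [hG, goodSet, Set.mem_ofPred_eq] at h3
          simp only [not_or, not_lt, not_not, ne_eq, and_true]
          exact h3

end RandomCoding

/-! ### Averaging over the source: the bound for one attack channel. -/

section Bound

variable {𝒮e 𝒮d 𝒰 𝒳 𝒴 : Type*} [MeasurableSpace 𝒮e] [MeasurableSpace 𝒮d]
    [MeasurableSpace 𝒰] [MeasurableSpace 𝒳] [MeasurableSpace 𝒴] {L : ℕ}

instance (P : Measure (𝒮e × 𝒮d)) [IsProbabilityMeasure P] (PUX : Kernel 𝒮e (𝒰 × 𝒳))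
    [IsMarkovKernel PUX] (A : Kernel 𝒳 𝒴) [IsMarkovKernel A] :
    IsProbabilityMeasure (jointLaw P PUX A) := by
  unfold jointLaw; infer_instance

lemma lintegral_jointLaw (P : Measure (𝒮e × 𝒮d)) [IsProbabilityMeasure P]
    (PUX : Kernel 𝒮e (𝒰 × 𝒳)) [IsMarkovKernel PUX] (A : Kernel 𝒳 𝒴) [IsMarkovKernel A]
    {f : ((𝒮e × 𝒮d) × (𝒰 × 𝒳)) × 𝒴 → ℝ≥0∞} (hf : Measurable f) :
    ∫⁻ ω, f ω ∂jointLaw P PUX A =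
      ∫⁻ s, ∫⁻ ux, ∫⁻ y, f ((s, ux), y) ∂A ux.2 ∂PUX s.1 ∂P := by
  rw [jointLaw, Measure.lintegral_compProd hf, Measure.lintegral_compProd]
  · rfl
  · exact hf.lintegral_kernel_prod_right'

/-- The law of `(S^e, U)` does not depend on the attack, so facts about the encoder's density can be
moved between an attack and `Â`. -/
lemma map_fst_jointLaw (P : Measure (𝒮e × 𝒮d)) [IsProbabilityMeasure P]
    (PUX : Kernel 𝒮e (𝒰 × 𝒳)) [IsMarkovKernel PUX] (A : Kernel 𝒳 𝒴) [IsMarkovKernel A] :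
    (jointLaw P PUX A).map (fun ω => (ω.1.1.1, ω.1.2.1)) = P.fst ⊗ₘ PUX.fst := by
  have hm : Measurable fun ω : ((𝒮e × 𝒮d) × (𝒰 × 𝒳)) × 𝒴 => (ω.1.1.1, ω.1.2.1) := by fun_prop
  refine Measure.ext_of_lintegral _ fun f hf => ?_
  have hf' : Measurable fun s => ∫⁻ u, f (s, u) ∂PUX.fst s := hf.lintegral_kernel_prod_right'
  rw [lintegral_map hf hm,
    lintegral_jointLaw P PUX A (f := fun ω => f (ω.1.1.1, ω.1.2.1)) (hf.comp hm),
    Measure.lintegral_compProd hf, Measure.fst, lintegral_map hf' measurable_fst]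
  refine lintegral_congr fun s => ?_
  rw [Kernel.fst_apply, lintegral_map (f := fun u => f (s.1, u)) (hf.comp measurable_prodMk_left)
    measurable_fst]
  simp

/-- The random coding bound for a single attack channel. -/
theorem lintegral_failure_add_gain_le
    (v₀ : 𝒰 × Fin L) {r : 𝒮e → 𝒰 → ℝ≥0} (hr : Measurable (Function.uncurry r))
    {q : 𝒴 × 𝒮d → 𝒰 → ℝ≥0} (hq : Measurable (Function.uncurry q))
    {g : 𝒮e × 𝒰 → unitInterval → 𝒳} (hg : Measurable (Function.uncurry g))
    {xhat : 𝒰 × Fin L × 𝒮d × 𝒴 → 𝒳} (hxhat : Measurable xhat)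
    {d₁ : 𝒮e → 𝒳 → ℝ≥0} (hd₁ : Measurable (Function.uncurry d₁))
    {d₂ : 𝒳 → 𝒳 → ℝ≥0} (hd₂ : Measurable (Function.uncurry d₂)) (D₁ D₂ : ℝ)
    (hL : 0 < L) (P : Measure (𝒮e × 𝒮d)) [IsProbabilityMeasure P]
    (μ : Measure 𝒰) [IsProbabilityMeasure μ]
    [IsProbabilityMeasure (uniformOn (Set.univ : Set (Fin L)))]
    (hr1 : ∀ s, ∫⁻ u, r s u ∂μ ≤ 1) (hq1 : ∀ y, ∫⁻ u, q y u ∂μ ≤ 1)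
    (A : Kernel 𝒳 𝒴) [IsMarkovKernel A]
    (PUX : Kernel 𝒮e (𝒰 × 𝒳)) [IsMarkovKernel PUX]
    (κ : Kernel (𝒮e × 𝒰) 𝒳) [IsMarkovKernel κ] (hκ : PUX.fst ⊗ₖ κ = PUX)
    (hgκ : ∀ a, volume.map (g a) = κ a)
    (hdens : ∀ᵐ s ∂P, PUX.fst s.1 = μ.withDensity fun u => r s.1 u) :
    ∫⁻ θ, (raceScheme v₀ hr hq hg hxhat θ).law P A
        ((raceScheme v₀ hr hq hg hxhat θ).failure d₁ d₂ D₁ D₂) ∂codebookLaw L μ +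
      ∫⁻ a, (goodSet d₁ d₂ D₁ D₂ xhat).indicator 1 a * gain L r q a.2
        ∂((uniformOn (Set.univ : Set (Fin L))).prod (jointLaw P PUX A)) ≤ 1 := by
  set c := raceScheme v₀ hr hq hg hxhat with hc
  obtain ⟨hkm, hlm⟩ := measurable_law_failure c
    (measurable_raceScheme_enc v₀ hr hq hg hxhat) (measurable_raceScheme_dec v₀ hr hq hg hxhat)
    hd₁ hd₂ D₁ D₂ P A
  have hfm (θ) := (c θ).measurableSet_failure hd₁ hd₂ D₁ D₂
  have hpr (θ) : IsProbabilityMeasure ((c θ).law P A) := by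
    unfold HidingScheme.law; infer_instance
  have hin : Measurable fun a : Fin L × (((𝒮e × 𝒮d) × (𝒰 × 𝒳)) × 𝒴) =>
      (goodSet d₁ d₂ D₁ D₂ xhat).indicator 1 a * gain L r q a.2 :=
    (measurable_one.indicator (measurableSet_goodSet hd₁ hd₂ D₁ D₂ hxhat)).mul
      ((measurable_gain L hr hq).comp measurable_snd)
  have hcm : Measurable fun a : ((ℕ → ℕ × (ℕ → ℝ × (𝒰 × Fin L))) × unitInterval) ×
      ((𝒮e × 𝒮d) × Fin L) => A ((c a.1).enc (a.2.1.1, a.2.2))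
        (Prod.mk a.2 ⁻¹' ((c a.1).failure d₁ d₂ D₁ D₂)ᶜ) := by
    simp_rw [Set.preimage_compl, fun a : ((ℕ → ℕ × (ℕ → ℝ × (𝒰 × Fin L))) × unitInterval) ×
      ((𝒮e × 𝒮d) × Fin L) => prob_compl_eq_one_sub (μ := A ((c a.1).enc (a.2.1.1, a.2.2)))
        (measurable_prodMk_left (x := a.2) (hfm a.1))]
    exact measurable_const.sub hkm
  have hsucc : ∫⁻ a, (goodSet d₁ d₂ D₁ D₂ xhat).indicator 1 a * gain L r q a.2
        ∂((uniformOn (Set.univ : Set (Fin L))).prod (jointLaw P PUX A)) ≤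
      ∫⁻ θ, (c θ).law P A ((c θ).failure d₁ d₂ D₁ D₂)ᶜ ∂codebookLaw L μ := by
    simp_rw [fun θ => (c θ).law_apply P A (hfm θ).compl]
    rw [lintegral_lintegral_swap hcm.aemeasurable, lintegral_prod _ hin.aemeasurable]
    have h1 (m : Fin L) := lintegral_jointLaw P PUX A (hin.comp (measurable_prodMk_left (x := m)))
    simp only [Function.comp_apply] at h1
    simp_rw [h1]
    have hin3 : Measurable fun b : ((Fin L × (𝒮e × 𝒮d)) × (𝒰 × 𝒳)) × 𝒴 =>
        (goodSet d₁ d₂ D₁ D₂ xhat).indicator (fun _ => (1 : ℝ≥0∞))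
          (b.1.1.1, ((b.1.1.2, b.1.2), b.2)) * gain L r q ((b.1.1.2, b.1.2), b.2) :=
      hin.comp (measurable_fst.fst.fst.prodMk
        ((measurable_fst.fst.snd.prodMk measurable_fst.snd).prodMk measurable_snd))
    have hin2 := hin3.lintegral_kernel_prod_right'
      (κ := A.comap (fun b : (Fin L × (𝒮e × 𝒮d)) × (𝒰 × 𝒳) => b.2.2) measurable_snd.snd)
    have hin1 := hin2.lintegral_kernel_prod_right'
      (κ := PUX.comap (fun b : Fin L × (𝒮e × 𝒮d) => b.2.1) measurable_snd.fst)
    rw [lintegral_lintegral_swap (f := fun (m : Fin L) (s : 𝒮e × 𝒮d) =>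
      ∫⁻ ux, ∫⁻ y, (goodSet d₁ d₂ D₁ D₂ xhat).indicator 1 (m, (s, ux), y) *
        gain L r q ((s, ux), y) ∂A ux.2 ∂PUX s.1) hin1.aemeasurable,
      ← lintegral_prod (fun p : (𝒮e × 𝒮d) × Fin L =>
      ∫⁻ ux, ∫⁻ y, (goodSet d₁ d₂ D₁ D₂ xhat).indicator 1 (p.2, (p.1, ux), y) *
        gain L r q ((p.1, ux), y) ∂A ux.2 ∂PUX p.1.1) (hin1.comp measurable_swap).aemeasurable]
    refine lintegral_mono_ae ?_
    filter_upwards [Measure.quasiMeasurePreserving_fst.ae hdens] with p hp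
    exact lintegral_success_ge v₀ hr hq hg hxhat hd₁ hd₂ D₁ D₂ hL μ hr1 hq1 A PUX κ hκ hgκ
      p.1.1 p.1.2 p.2 hp
  refine (add_le_add le_rfl hsucc).trans ?_
  rw [← lintegral_add_left hlm]
  simp_rw [fun θ => prob_add_prob_compl (μ := (c θ).law P A) (hfm θ)]
  simp

/-- The integrand of the theorem and the guaranteed success probability are complementary. Stating
this as a sum avoids truncated subtraction in `ℝ≥0∞`. -/
lemma ofReal_loss_add_gain {L : ℕ} {r q : ℝ≥0} (hr : r ≠ 0) (hq : q ≠ 0) {α β : Type*}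
    (s : Set α) (t : Set β) (a : α) (b : β) {γ : Type*} (G : Set γ) (x : γ)
    (hG : x ∈ G ↔ a ∈ s ∧ b ∈ t) :
    ENNReal.ofReal (1 - s.indicator 1 a * t.indicator 1 b *
        (1 + (L : ℝ) * (2 : ℝ) ^ (-(log2E q).toReal + (log2E r).toReal))⁻¹) +
      G.indicator 1 x * (1 + L * r * (q : ℝ≥0∞)⁻¹)⁻¹ = 1 := by
  rw [two_rpow_sub_log2E hr hq]
  have hT : (1 + L * r * (q : ℝ≥0∞)⁻¹)⁻¹ = ENNReal.ofReal (1 + (L : ℝ) * (r / q))⁻¹ := by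
    rw [ENNReal.ofReal_inv_of_pos (by positivity), ENNReal.ofReal_add zero_le_one (by positivity),
      ENNReal.ofReal_one, ENNReal.ofReal_mul (by positivity), ENNReal.ofReal_natCast,
      ENNReal.ofReal_div_of_pos (by positivity), ENNReal.ofReal_coe_nnreal,
      ENNReal.ofReal_coe_nnreal, div_eq_mul_inv, mul_assoc]
  have h1 : (1 + (L : ℝ) * (r / q))⁻¹ ≤ 1 :=
    inv_le_one_of_one_le₀ (le_add_of_nonneg_right (by positivity))
  by_cases h : a ∈ s ∧ b ∈ t
  · rw [Set.indicator_of_mem h.1, Set.indicator_of_mem h.2, Set.indicator_of_mem (hG.2 h), hT]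
    simp only [Pi.one_apply, one_mul]
    rw [← ENNReal.ofReal_add (sub_nonneg.2 h1) (by positivity), sub_add_cancel, ENNReal.ofReal_one]
  · rw [Set.indicator_of_notMem (fun hx => h (hG.1 hx))]
    have : s.indicator (1 : α → ℝ) a * t.indicator (1 : β → ℝ) b = 0 := by
      rw [not_and_or] at h
      rcases h with h | h <;> simp [h]
    simp [this]

end Bound

end

/-! ### One codebook for the whole class of attacks. -/

theorem mainTheorem4
    {𝒮e 𝒮d 𝒰 𝒳 𝒴 : Type*} [MeasurableSpace 𝒮e] [MeasurableSpace 𝒮d]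
    [MeasurableSpace 𝒰] [StandardBorelSpace 𝒰] [MeasurableSpace 𝒳] [StandardBorelSpace 𝒳]
    [MeasurableSpace 𝒴]
    -- the number of messages, the law of the side information, and the class of attack channels
    (L : ℕ) (hL : 0 < L)
    (P : Measure (𝒮e × 𝒮d)) [IsProbabilityMeasure P]
    (𝒜 : Set (Kernel 𝒳 𝒴)) (h𝒜 : ∀ A ∈ 𝒜, IsMarkovKernel A)
    -- the distortion measures and levels
    (d₁ : 𝒮e → 𝒳 → ℝ≥0) (hd₁ : Measurable (Function.uncurry d₁))
    (d₂ : 𝒳 → 𝒳 → ℝ≥0) (hd₂ : Measurable (Function.uncurry d₂))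
    (D₁ D₂ : ℝ)
    -- `P_{U,X|S^e}`, the channel `Â`, and the reconstruction function `X̂ = xhat(U, M, S^d, Y)`
    (PUX : Kernel 𝒮e (𝒰 × 𝒳)) [IsMarkovKernel PUX]
    (Ahat : Kernel 𝒳 𝒴) [IsMarkovKernel Ahat]
    (xhat : 𝒰 × Fin L × 𝒮d × 𝒴 → 𝒳) (hxhat : Measurable xhat)
    -- the information densities `ι(u; s^e)` and `ι̂(u; y, s^d)`, computed under `Â`
    (ι : 𝒰 → 𝒮e → EReal)
    (hι : IsInfoDensity ((jointLaw P PUX Ahat).map (fun ω => (ω.1.2.1, ω.1.1.1))) ι)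
    (ιhat : 𝒰 → 𝒴 × 𝒮d → EReal)
    (hιhat : IsInfoDensity
      ((jointLaw P PUX Ahat).map (fun ω => (ω.1.2.1, (ω.2, ω.1.1.2)))) ιhat)
    -- they are almost surely finite under every attack channel
    (hfin : ∀ A ∈ 𝒜, ∀ᵐ ω ∂(jointLaw P PUX A),
      (ι ω.1.2.1 ω.1.1.1 ≠ ⊥ ∧ ι ω.1.2.1 ω.1.1.1 ≠ ⊤) ∧
      (ιhat ω.1.2.1 (ω.2, ω.1.1.2) ≠ ⊥ ∧ ιhat ω.1.2.1 (ω.2, ω.1.1.2) ≠ ⊤))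
    (ε : ℝ≥0) :
    ∃ c : HidingScheme 𝒮e 𝒮d 𝒳 𝒴 L,
      c.failureProb P 𝒜 d₁ d₂ D₁ D₂ ≤
        (coveringNumber ε 𝒜 : ℝ≥0∞) *
          (⨆ A ∈ 𝒜, ∫⁻ ω, (
              let m : Fin L := ω.1
              let se : 𝒮e := ω.2.1.1.1
              let sd : 𝒮d := ω.2.1.1.2
              let u : 𝒰 := ω.2.1.2.1
              let x : 𝒳 := ω.2.1.2.2
              let y : 𝒴 := ω.2.2
              ENNReal.ofReal (1 -
                Set.indicator {p : 𝒮e × 𝒳 | d₁ p.1 p.2 ≤ D₁} 1 (se, x) *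
                Set.indicator {p : 𝒳 × 𝒳 | d₂ p.1 p.2 ≤ D₂} 1 (x, xhat (u, m, sd, y)) *
                (1 + (L : ℝ) * (2 : ℝ) ^ (-(ιhat u (y, sd)).toReal + (ι u se).toReal))⁻¹))
            ∂((uniformOn (Set.univ : Set (Fin L))).prod (jointLaw P PUX A)))
        + (ε : ℝ≥0∞) := by
  classical
  obtain ⟨⟨se₀, sd₀⟩⟩ : Nonempty (𝒮e × 𝒮d) := nonempty_of_isProbabilityMeasure P
  obtain ⟨⟨u₀, x₀⟩⟩ : Nonempty (𝒰 × 𝒳) := nonempty_of_isProbabilityMeasure (PUX se₀)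
  have : Nonempty 𝒳 := ⟨x₀⟩
  have hunif := isProbabilityMeasure_uniformOn_univ_fin hL
  set v₀ : 𝒰 × Fin L := (u₀, ⟨0, hL⟩)
  set J := jointLaw P PUX Ahat with hJ
  have hm₁ : Measurable fun ω : ((𝒮e × 𝒮d) × (𝒰 × 𝒳)) × 𝒴 => (ω.1.2.1, ω.1.1.1) := by fun_prop
  have hm₂ : Measurable fun ω : ((𝒮e × 𝒮d) × (𝒰 × 𝒳)) × 𝒴 => (ω.1.2.1, (ω.2, ω.1.1.2)) := by
    fun_prop
  have hmU : Measurable fun ω : ((𝒮e × 𝒮d) × (𝒰 × 𝒳)) × 𝒴 => ω.1.2.1 := by fun_prop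
  have hP₁ := Measure.isProbabilityMeasure_map (μ := J) hm₁.aemeasurable
  have hP₂ := Measure.isProbabilityMeasure_map (μ := J) hm₂.aemeasurable
  set μ : Measure 𝒰 := J.map fun ω => ω.1.2.1 with hμ
  have hμp : IsProbabilityMeasure μ := Measure.isProbabilityMeasure_map hmU.aemeasurable
  have hfst₁ : (J.map fun ω => (ω.1.2.1, ω.1.1.1)).fst = μ := by
    rw [Measure.fst, Measure.map_map measurable_fst hm₁]; rfl
  have hfst₂ : (J.map fun ω => (ω.1.2.1, (ω.2, ω.1.1.2))).fst = μ := by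
    rw [Measure.fst, Measure.map_map measurable_fst hm₂]; rfl
  have hswap (A : Kernel 𝒳 𝒴) [IsMarkovKernel A] :
      (jointLaw P PUX A).map (fun ω => (ω.1.2.1, ω.1.1.1)) =
        (P.fst ⊗ₘ PUX.fst).map Prod.swap := by
    rw [← map_fst_jointLaw P PUX A, Measure.map_map measurable_swap (by fun_prop)]
    rfl
  obtain ⟨r, hr, hr1, hιr, hrη⟩ := hι.exists_density
  -- The decoder's density serves only as a weight of mass at most one; it need not be the
  -- conditional density under the actual attack.
  obtain ⟨q, hq, hq1, hιq, -⟩ := hιhat.exists_density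
  rw [hfst₁] at hr1 hrη
  rw [hfst₂] at hq1
  have hsnd₁ : (J.map fun ω => (ω.1.2.1, ω.1.1.1)).snd = P.fst := by
    rw [hJ, hswap Ahat, Measure.snd, Measure.map_map measurable_snd measurable_swap]
    exact Measure.fst_compProd _ _
  -- Finiteness is assumed only under attacks in `𝒜`. Any one of them suffices, since the law of
  -- `(U, S^e)` is the same as under `Â`.
  have hdens₀ : 𝒜.Nonempty → ∀ᵐ s ∂P, PUX.fst s.1 = μ.withDensity fun u => r u s.1 := by
    rintro ⟨A, hA⟩
    have := h𝒜 A hA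
    have h := hrη PUX.fst inferInstance (by
      rw [hsnd₁, hJ, hswap Ahat, Measure.map_map measurable_swap measurable_swap]
      simp) (by
      rw [hJ, hswap Ahat, ← hswap A]
      refine (ae_map_iff (p := fun p : 𝒰 × 𝒮e => r p.1 p.2 ≠ ∞) hm₁.aemeasurable
        (hr (measurableSet_singleton ∞)).compl).2 ?_
      filter_upwards [hfin A hA] with ω hω htop
      exact hω.1.2 (by rw [hιr, htop, log2E_top]))
    rw [hsnd₁] at h
    exact ae_of_ae_map measurable_fst.aemeasurable h
  -- Infinite values become zero. This does not increase the masses, changes `r` only on a `μ`-null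
  -- set for each `s`, and by `hfin` is almost surely invisible under every attack.
  set r' : 𝒮e → 𝒰 → ℝ≥0 := fun s u => (r u s).toNNReal with hr'
  set q' : 𝒴 × 𝒮d → 𝒰 → ℝ≥0 := fun y u => (q u y).toNNReal with hq'
  have hr'm : Measurable (Function.uncurry r') := (hr.comp measurable_swap).ennreal_toNNReal
  have hq'm : Measurable (Function.uncurry q') := (hq.comp measurable_swap).ennreal_toNNReal
  have hr'1 (s) : ∫⁻ u, r' s u ∂μ ≤ 1 :=
    (lintegral_mono fun u => ENNReal.coe_toNNReal_le_self).trans (hr1 s)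
  have hq'1 (y) : ∫⁻ u, q' y u ∂μ ≤ 1 :=
    (lintegral_mono fun u => ENNReal.coe_toNNReal_le_self).trans (hq1 y)
  have hwd (s : 𝒮e) : (μ.withDensity fun u => r u s) = μ.withDensity fun u => r' s u := by
    refine withDensity_congr_ae ?_
    filter_upwards [ae_lt_top (hr.comp measurable_prodMk_right)
      ((hr1 s).trans_lt ENNReal.one_lt_top).ne] with u hu
    exact (ENNReal.coe_toNNReal (ne_of_lt hu)).symm
  set κ : Kernel (𝒮e × 𝒰) 𝒳 := PUX.condKernel
  have hκ : PUX.fst ⊗ₖ κ = PUX := PUX.disintegrate _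
  -- Functional representation: `X` becomes a measurable function of `(S^e, U)` and an independent
  -- uniform variable.
  obtain ⟨g, hg, hgκ⟩ := κ.exists_measurable_map_eq_unitInterval
  set c := raceScheme v₀ hr'm hq'm hg hxhat with hc
  set loss : Fin L × (((𝒮e × 𝒮d) × (𝒰 × 𝒳)) × 𝒴) → ℝ≥0∞ := fun ω =>
      ENNReal.ofReal (1 -
        Set.indicator {p : 𝒮e × 𝒳 | d₁ p.1 p.2 ≤ D₁} 1 (ω.2.1.1.1, ω.2.1.2.2) *
        Set.indicator {p : 𝒳 × 𝒳 | d₂ p.1 p.2 ≤ D₂} 1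
          (ω.2.1.2.2, xhat (ω.2.1.2.1, ω.1, ω.2.1.1.2, ω.2.2)) *
        (1 + (L : ℝ) * (2 : ℝ) ^ (-(ιhat ω.2.1.2.1 (ω.2.2, ω.2.1.1.2)).toReal +
          (ι ω.2.1.2.1 ω.2.1.1.1).toReal))⁻¹) with hloss
  set G : Fin L × (((𝒮e × 𝒮d) × (𝒰 × 𝒳)) × 𝒴) → ℝ≥0∞ := fun a =>
    (goodSet d₁ d₂ D₁ D₂ xhat).indicator 1 a * gain L r' q' a.2 with hG
  have hGm : Measurable G :=
    (measurable_one.indicator (measurableSet_goodSet hd₁ hd₂ D₁ D₂ hxhat)).mul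
      ((measurable_gain L hr'm hq'm).comp measurable_snd)
  have hae (A) (hA : A ∈ 𝒜) : ∀ᵐ a ∂(uniformOn (Set.univ : Set (Fin L))).prod (jointLaw P PUX A),
      loss a + G a = 1 ∧ G a < 1 := by
    have := h𝒜 A hA
    filter_upwards [Measure.quasiMeasurePreserving_snd.ae (hfin A hA)] with a ha
    obtain ⟨⟨h1, h2⟩, h3, h4⟩ := ha
    have e1 : r a.2.1.2.1 a.2.1.1.1 = r' a.2.1.1.1 a.2.1.2.1 :=
      (ENNReal.coe_toNNReal fun h => h2 (by rw [hιr, h, log2E_top])).symm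
    have e2 : q a.2.1.2.1 (a.2.2, a.2.1.1.2) = q' (a.2.2, a.2.1.1.2) a.2.1.2.1 :=
      (ENNReal.coe_toNNReal fun h => h4 (by rw [hιq, h, log2E_top])).symm
    have n1 : r' a.2.1.1.1 a.2.1.2.1 ≠ 0 := fun h =>
      h1 (by rw [hιr, e1, h, ENNReal.coe_zero, log2E_zero])
    have n2 : q' (a.2.2, a.2.1.1.2) a.2.1.2.1 ≠ 0 := fun h =>
      h3 (by rw [hιq, e2, h, ENNReal.coe_zero, log2E_zero])
    constructor
    · simp only [hloss, hG, gain]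
      rw [hιr, hιq, e1, e2]
      exact ofReal_loss_add_gain n1 n2 _ _ _ _ _ _ Iff.rfl
    · refine lt_of_le_of_lt (mul_le_of_le_one_left zero_le
        (Set.indicator_le_self' (fun _ _ => zero_le) a)) ?_
      rw [gain, ENNReal.inv_lt_one]
      refine ENNReal.lt_add_right ENNReal.one_ne_top (mul_ne_zero (mul_ne_zero ?_ ?_) ?_)
      · exact_mod_cast hL.ne'
      · exact_mod_cast n1
      · simp
  have hsum (A) (hA : A ∈ 𝒜) :
      ∫⁻ a, loss a ∂(uniformOn (Set.univ : Set (Fin L))).prod (jointLaw P PUX A) +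
        ∫⁻ a, G a ∂(uniformOn (Set.univ : Set (Fin L))).prod (jointLaw P PUX A) = 1 := by
    have := h𝒜 A hA
    rw [← lintegral_add_right _ hGm, lintegral_congr_ae ((hae A hA).mono fun a ha => ha.1)]
    simp
  have hGt (A) (hA : A ∈ 𝒜) :
      ∫⁻ a, G a ∂(uniformOn (Set.univ : Set (Fin L))).prod (jointLaw P PUX A) ≠ ∞ :=
    ((le_add_self.trans (hsum A hA).le).trans_lt ENNReal.one_lt_top).ne
  have hbound (A) (hA : A ∈ 𝒜) :
      ∫⁻ θ, (c θ).law P A ((c θ).failure d₁ d₂ D₁ D₂) ∂codebookLaw L μ ≤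
        ∫⁻ a, loss a ∂(uniformOn (Set.univ : Set (Fin L))).prod (jointLaw P PUX A) := by
    have := h𝒜 A hA
    refine (ENNReal.add_le_add_iff_right (hGt A hA)).1 ?_
    rw [hsum A hA]
    exact lintegral_failure_add_gain_le v₀ hr'm hq'm hg hxhat hd₁ hd₂ D₁ D₂ hL P μ hr'1 hq'1 A PUX
      κ hκ hgκ ((hdens₀ ⟨A, hA⟩).mono fun s hs => by rw [hs, hwd])
  -- Needed when the covering number is infinite: since `∞ * 0 = 0` in `ℝ≥0∞`, the bound is trivial
  -- there only if the supremum is nonzero. It is nonzero because `G < 1` almost surely.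
  have hpos (A) (hA : A ∈ 𝒜) :
      ∫⁻ a, loss a ∂(uniformOn (Set.univ : Set (Fin L))).prod (jointLaw P PUX A) ≠ 0 := by
    have := h𝒜 A hA
    intro h0
    have h1 := hsum A hA
    rw [h0, zero_add] at h1
    have h2 : ∫⁻ a, (1 - G a)
        ∂(uniformOn (Set.univ : Set (Fin L))).prod (jointLaw P PUX A) = 0 := by
      rw [lintegral_sub hGm (hGt A hA) ((hae A hA).mono fun a ha => ha.2.le), h1]
      simp
    rw [lintegral_eq_zero_iff (f := fun a => 1 - G a) (measurable_const.sub hGm)] at h2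
    obtain ⟨a, ha, hb⟩ := (h2.and (hae A hA)).exists
    exact absurd (tsub_eq_zero_iff_le.1 ha) (not_le.2 hb.2)
  change ∃ c : HidingScheme 𝒮e 𝒮d 𝒳 𝒴 L, c.failureProb P 𝒜 d₁ d₂ D₁ D₂ ≤
    (coveringNumber ε 𝒜 : ℝ≥0∞) * (⨆ A ∈ 𝒜, ∫⁻ a, loss a
      ∂(uniformOn (Set.univ : Set (Fin L))).prod (jointLaw P PUX A)) + ε
  set M : ℝ≥0∞ := ⨆ A ∈ 𝒜, ∫⁻ a, loss a
      ∂(uniformOn (Set.univ : Set (Fin L))).prod (jointLaw P PUX A) with hM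
  have hleM (A) (hA : A ∈ 𝒜) :
      ∫⁻ a, loss a ∂(uniformOn (Set.univ : Set (Fin L))).prod (jointLaw P PUX A) ≤ M :=
    le_iSup₂_of_le A hA le_rfl
  obtain ⟨θ₀⟩ : Nonempty ((ℕ → ℕ × (ℕ → ℝ × (𝒰 × Fin L))) × unitInterval) :=
    nonempty_of_isProbabilityMeasure (codebookLaw L μ)
  rcases 𝒜.eq_empty_or_nonempty with hemp | ⟨A₀, hA₀⟩
  · exact ⟨c θ₀, by simp [HidingScheme.failureProb, hemp]⟩
  by_cases hN : coveringNumber ε 𝒜 = ⊤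
  · have hM0 : M ≠ 0 := fun h => hpos A₀ hA₀ (le_antisymm (h ▸ hleM A₀ hA₀) zero_le)
    exact ⟨c θ₀, by simp [hN, ENNReal.top_mul hM0]⟩
  obtain ⟨T, hT⟩ := ENat.exists_eq_iInf fun T : Set (Kernel 𝒳 𝒴) =>
    ⨅ (_ : T ⊆ 𝒜 ∧ ∀ A ∈ 𝒜, ∃ B ∈ T, channelDist A B ≤ (ε : ℝ≥0∞)), T.encard
  have hTN : (⨅ (_ : T ⊆ 𝒜 ∧ ∀ A ∈ 𝒜, ∃ B ∈ T, channelDist A B ≤ (ε : ℝ≥0∞)), T.encard) =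
    coveringNumber ε 𝒜 := hT
  -- A minimiser `T` that is not a cover would give the inner infimum the value `⊤`, against `hN`.
  by_cases hcov : T ⊆ 𝒜 ∧ ∀ A ∈ 𝒜, ∃ B ∈ T, channelDist A B ≤ (ε : ℝ≥0∞)
  swap
  · rw [iInf_neg hcov] at hTN
    exact absurd hTN.symm hN
  rw [iInf_pos hcov] at hTN
  have hTf : T.Finite := Set.encard_ne_top_iff.1 (hTN ▸ hN)
  have hmeas (A) (hA : A ∈ hTf.toFinset) :
      Measurable fun θ => (c θ).law P A ((c θ).failure d₁ d₂ D₁ D₂) := by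
    have := h𝒜 A (hcov.1 (hTf.mem_toFinset.1 hA))
    exact (measurable_law_failure c (measurable_raceScheme_enc v₀ hr'm hq'm hg hxhat)
      (measurable_raceScheme_dec v₀ hr'm hq'm hg hxhat) hd₁ hd₂ D₁ D₂ P A).2
  -- Derandomization: some codebook makes the sum over the cover at most its mean. Using the sum
  -- rather than the maximum is what produces the factor `N_ε`.
  obtain ⟨θ, hθ⟩ := exists_le_lintegral (μ := codebookLaw L μ)
    (Finset.measurable_fun_sum hTf.toFinset hmeas).aemeasurable
  have hTotal : ∑ A ∈ hTf.toFinset, (c θ).law P A ((c θ).failure d₁ d₂ D₁ D₂) ≤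
      (coveringNumber ε 𝒜 : ℝ≥0∞) * M := by
    refine hθ.trans ?_
    rw [lintegral_finsetSum _ hmeas, ← hTN, hTf.encard_eq_coe_toFinset_card]
    refine (Finset.sum_le_card_nsmul _ _ M fun A hA => ?_).trans (by simp)
    have hA' := hcov.1 (hTf.mem_toFinset.1 hA)
    exact (hbound A hA').trans (hleM A hA')
  refine ⟨c θ, iSup₂_le fun A hA => ?_⟩
  obtain ⟨B, hB, hAB⟩ := hcov.2 A hA
  have := h𝒜 A hA
  have := h𝒜 B (hcov.1 hB)
  refine ((c θ).law_le_add_of_channelDist_le hL P A B hAB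
    ((c θ).measurableSet_failure hd₁ hd₂ D₁ D₂)).trans (add_le_add_left ?_ _)
  exact (Finset.single_le_sum (f := fun A => (c θ).law P A ((c θ).failure d₁ d₂ D₁ D₂))
    (fun _ _ => zero_le) (hTf.mem_toFinset.2 hB)).trans hTotal
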